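/- Let $d\ge 0$ and $m\ge 2$ be integers. Consider the rays of the $m$-ary tree, that is, the infinite words $\cdots x_2x_1x_0$ with letters in $\{0,\dots,m-1\}$, read from right to left. Let $L_{-1}\cong \mathrm{Sym}(m)$ be the group of permutations of the set of rays that act on the first letter $x_0$ only. For $k\ge 0$, a word $w$ of length $k$ in the letters $\{1,\dots,m-1\}$, and $\sigma\in \mathrm{Sym}(m)\wr \mathrm{Sym}(m-1)$ (the automorphisms of the first two levels of the $m$-ary tree that fix $0$ and its children, acting on the two-letter words whose first-read letter is nonzero), let $\lambda_{w,\sigma}$ be the permutation of the rays which, if the first $k$ nonzero letters of a ray form the word $w$, permutes the $(k+1)$-st nonzero letter and the letter read immediately after it by $\sigma$, and otherwise does nothing. Let $L_k$ be the (finite) group generated by all $\lambda_{w,\sigma}$ with $|w|=k$. The group generated by $L_{-1},L_0,\dots,L_d$ is the mother group of degree $d$ on $m$ letters. The infinite fractal mother graph $\mathcal G(d,m,\infty)$ is the connected component of the zero ray $\cdots 000$ in the Schreier graph of the action of this group on the set of rays with the generating set $\bigcup_{k=-1}^{d}L_k$, where generators (hence edges) are counted with multiplicity. If $d\ge 4$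 and $m\ge 2$, or if $d\ge 3$ and $m\ge 3$, then $\mathcal G(d,m,\infty)$ is transient; that is, the simple random walk on it, from any starting vertex, almost surely visits each vertex only finitely many times. -/

import Mathlib

open MeasureTheory

/-! ### Random walks on Schreier graphs -/

/-- The simple graph underlying the Schreier graph of a family `s` of permutations of `X`: distinct
points are adjacent when one of the `s i` maps one of them to the other. -/
def schreierAdj {ι X : Type*} (s : ι → Equiv.Perm X) : SimpleGraph X :=
  SimpleGraph.fromRel fun x y => ∃ i, s i x = y

/-- The vertex set of the connected component of `o` in the Schreier graph of `s`. -/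
def schreierComponent {ι X : Type*} (s : ι → Equiv.Perm X) (o : X) : Set X :=
  ((schreierAdj s).connectedComponentMk o).supp

theorem mem_schreierComponent_apply {ι X : Type*} (s : ι → Equiv.Perm X) (o : X) (i : ι) (x : X) :
    s i x ∈ schreierComponent s o ↔ x ∈ schreierComponent s o := by
  have h : (schreierAdj s).Reachable (s i x) x := by
    by_cases hx : x = s i x
    · rw [← hx]
    · exact (SimpleGraph.Adj.reachable
        (show (schreierAdj s).Adj x (s i x) from ⟨hx, Or.inl ⟨i, rfl⟩⟩)).symm
  simp only [schreierComponent, SimpleGraph.ConnectedComponent.mem_supp_iff,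
    SimpleGraph.ConnectedComponent.eq]
  exact ⟨fun hx => h.symm.trans hx, fun hx => h.trans hx⟩

/-- The connected component of `o` in the Schreier graph of `s`, as a Schreier graph: the labelled
multigraph on the component having, for every vertex `x` and every label `i`, an edge from `x` to
`s i x`. (When the family `s` runs through finitely many groups, as it does below, the edges can be
reversed, and so this is an undirected multigraph.) -/
def schreierRestrict {ι X : Type*} (s : ι → Equiv.Perm X) (o : X) :
    ι → Equiv.Perm (schreierComponent s o) :=
  fun i => (s i).subtypePerm (mem_schreierComponent_apply s o i)

/-- The trajectory started at `x` that follows the edge labelled `ω n` at time `n`. -/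
def schreierWalk {ι V : Type*} (s : ι → Equiv.Perm V) (x : V) (ω : ℕ → ι) : ℕ → V
  | 0 => x
  | n + 1 => s (ω n) (schreierWalk s x ω n)

/-- The law of a sequence of independent uniformly distributed labels. -/
noncomputable def uniformLabels (ι : Type*) [Fintype ι] [Nonempty ι] :
    @Measure (ℕ → ι) (@MeasurableSpace.pi ℕ (fun _ => ι) (fun _ => ⊤)) :=
  letI : MeasurableSpace ι := ⊤
  Measure.infinitePi fun _ : ℕ => (PMF.uniformOfFintype ι).toMeasure

/-- The Schreier graph of `s` is transient: the simple random walk on it (which at every step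
leaves the current vertex along one of the labelled edges there, chosen uniformly at random),
from any starting vertex, almost surely visits any given vertex only finitely often. -/
def IsTransientSchreier {ι V : Type*} [Fintype ι] [Nonempty ι] (s : ι → Equiv.Perm V) : Prop :=
  letI : MeasurableSpace ι := ⊤
  ∀ x y : V, ∀ᵐ ω ∂(uniformLabels ι), {n : ℕ | schreierWalk s x ω n = y}.Finite

/-! ### The level subgroups of the mother groups -/

/-- Infinite words in the alphabet `{0, …, m-1}`; the letter `v 0` is the first one that is read
(the rightmost one, if words are written from right to left). -/
abbrev Ray (m : ℕ) := ℕ → Fin m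

/-- The nonzero letters. -/
abbrev NonzeroLetter (m : ℕ) [NeZero m] := {x : Fin m // x ≠ 0}

/-- The zero ray `⋯000`. -/
def zeroRay (m : ℕ) [NeZero m] : Ray m := fun _ => 0

/-- The group `Sym(m) ≀ Sym(m-1)` of automorphisms of the first two levels of the `m`-ary tree that
fix `0` and its children: the permutations of the words `xy` with `x ≠ 0` that preserve the relation
of having the same parent `x`. -/
def TwoLevelAut (m : ℕ) [NeZero m] : Subgroup (Equiv.Perm (NonzeroLetter m × Fin m)) where
  carrier := {σ | ∀ p q, (σ p).1 = (σ q).1 ↔ p.1 = q.1}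
  one_mem' := fun _ _ => Iff.rfl
  mul_mem' := fun {a b} ha hb p q => (ha (b p) (b q)).trans (hb p q)
  inv_mem' := fun {a} ha p q => by
    have := ha (a⁻¹ p) (a⁻¹ q)
    simpa using this.symm

/-- `p` is the position of the `(k+1)`-st nonzero letter of `v`. -/
def IsNonzeroPos {m : ℕ} [NeZero m] (v : Ray m) (k p : ℕ) : Prop :=
  v p ≠ 0 ∧ Nat.count (fun i => v i ≠ 0) p = k

/-- The word formed by the first `k` nonzero letters of `v` (if `v` has that many). -/
noncomputable def nonzeroPrefix {m : ℕ} [NeZero m] (k : ℕ) (v : Ray m) : Fin k → Fin m :=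
  fun j => v (Nat.nth (fun i => v i ≠ 0) j)

/-- Apply `σ` to the nonzero letter of `v` in position `p` and the letter following it. -/
def applyAt {m : ℕ} [NeZero m] (σ : TwoLevelAut m) (v : Ray m) (p : ℕ) (hp : v p ≠ 0) : Ray m :=
  fun i =>
    if i = p then (σ.1 (⟨v p, hp⟩, v (p + 1))).1
    else if i = p + 1 then (σ.1 (⟨v p, hp⟩, v (p + 1))).2
    else v i

open Classical in
/-- If `v` has at least `k + 1` nonzero letters, the first `k` of them forming the word `u`, then
permute the `(k+1)`-st nonzero letter and the letter following it by `g u`; otherwise do nothing. -/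
noncomputable def levelMap {m k : ℕ} [NeZero m] (g : (Fin k → Fin m) → TwoLevelAut m)
    (v : Ray m) : Ray m :=
  if h : ∃ p, IsNonzeroPos v k p then
    applyAt (g (nonzeroPrefix k v)) v h.choose h.choose_spec.1
  else v

theorem IsNonzeroPos.unique {m : ℕ} [NeZero m] {v : Ray m} {k p q : ℕ}
    (hp : IsNonzeroPos v k p) (hq : IsNonzeroPos v k q) : p = q :=
  Nat.count_injective hp.1 hq.1 (hp.2.trans hq.2.symm)

theorem levelMap_of_pos {m k : ℕ} [NeZero m] (g : (Fin k → Fin m) → TwoLevelAut m)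
    {v : Ray m} {p : ℕ} (hp : IsNonzeroPos v k p) :
    levelMap g v = applyAt (g (nonzeroPrefix k v)) v p hp.1 := by
  have h : ∃ p, IsNonzeroPos v k p := ⟨p, hp⟩
  have hq : h.choose = p := h.choose_spec.unique hp
  rw [levelMap, dif_pos h]
  congr 1

theorem levelMap_of_not {m k : ℕ} [NeZero m] (g : (Fin k → Fin m) → TwoLevelAut m)
    {v : Ray m} (h : ¬ ∃ p, IsNonzeroPos v k p) : levelMap g v = v := by
  rw [levelMap, dif_neg h]

theorem applyAt_one {m : ℕ} [NeZero m] (v : Ray m) (p : ℕ) (hp : v p ≠ 0) :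
    applyAt 1 v p hp = v := by
  funext i
  simp only [applyAt]
  split_ifs with h1 h2
  · subst h1; rfl
  · subst h2; rfl
  · rfl

theorem applyAt_ne_zero {m : ℕ} [NeZero m] (σ : TwoLevelAut m) (v : Ray m) (p : ℕ)
    (hp : v p ≠ 0) : applyAt σ v p hp p ≠ 0 := by
  simpa [applyAt] using (σ.1 (⟨v p, hp⟩, v (p + 1))).1.2

theorem applyAt_mul {m : ℕ} [NeZero m] (σ τ : TwoLevelAut m) (v : Ray m) (p : ℕ)
    (hp : v p ≠ 0) :
    applyAt σ (applyAt τ v p hp) p (applyAt_ne_zero τ v p hp) = applyAt (σ * τ) v p hp := by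
  funext i
  simp [applyAt]
  split_ifs <;> rfl

theorem applyAt_of_lt {m : ℕ} [NeZero m] (σ : TwoLevelAut m) (v : Ray m) (p : ℕ)
    (hp : v p ≠ 0) {i : ℕ} (hi : i < p) : applyAt σ v p hp i = v i := by
  simp [applyAt, hi.ne, (hi.trans (Nat.lt_succ_self p)).ne]

theorem count_congr_below {P Q : ℕ → Prop} [DecidablePred P] [DecidablePred Q] {p : ℕ}
    (h : ∀ i < p, (P i ↔ Q i)) : Nat.count P p = Nat.count Q p := by
  induction p with
  | zero => simp
  | succ n ih =>
    rw [Nat.count_succ, Nat.count_succ, ih fun i hi => h i (hi.trans (Nat.lt_succ_self n))]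
    simp [h n (Nat.lt_succ_self n)]

theorem isNonzeroPos_applyAt {m k : ℕ} [NeZero m] (σ : TwoLevelAut m) {v : Ray m} {p : ℕ}
    (hp : IsNonzeroPos v k p) : IsNonzeroPos (applyAt σ v p hp.1) k p := by
  refine ⟨applyAt_ne_zero σ v p hp.1, ?_⟩
  refine Eq.trans ?_ hp.2
  exact count_congr_below fun i hi => by rw [applyAt_of_lt σ v p hp.1 hi]

theorem nonzeroPrefix_congr {m k : ℕ} [NeZero m] {u v : Ray m} {p : ℕ}
    (hv : IsNonzeroPos v k p) (h : ∀ i < p, u i = v i) :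
    nonzeroPrefix k u = nonzeroPrefix k v := by
  funext j
  have hj : (j : ℕ) < Nat.count (fun i => v i ≠ 0) p := by rw [hv.2]; exact j.2
  have hlt : Nat.nth (fun i => v i ≠ 0) j < p := Nat.nth_lt_of_lt_count hj
  have hne : v (Nat.nth (fun i => v i ≠ 0) j) ≠ 0 := by
    refine Nat.nth_mem (p := fun i => v i ≠ 0) j fun hf => hj.trans_le ?_
    exact Nat.count_le_card hf p
  have hcount : Nat.count (fun i => u i ≠ 0) (Nat.nth (fun i => v i ≠ 0) j) = j := by
    rw [count_congr_below (Q := fun i => v i ≠ 0) fun i hi => by rw [h i (hi.trans hlt)]]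
    refine Nat.count_nth fun hf => hj.trans_le ?_
    exact Nat.count_le_card hf p
  have hn : Nat.nth (fun i => u i ≠ 0) j = Nat.nth (fun i => v i ≠ 0) j := by
    have := Nat.nth_count (p := fun i => u i ≠ 0)
      (show u (Nat.nth (fun i => v i ≠ 0) j) ≠ 0 by rw [h _ hlt]; exact hne)
    rwa [hcount] at this
  simp only [nonzeroPrefix]
  rw [hn, h _ hlt]

theorem levelMap_one {m k : ℕ} [NeZero m] (v : Ray m) :
    levelMap (1 : (Fin k → Fin m) → TwoLevelAut m) v = v := by
  by_cases h : ∃ p, IsNonzeroPos v k p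
  · obtain ⟨p, hp⟩ := h
    rw [levelMap_of_pos _ hp]
    exact applyAt_one v p hp.1
  · exact levelMap_of_not _ h

theorem levelMap_mul {m k : ℕ} [NeZero m] (g h : (Fin k → Fin m) → TwoLevelAut m) (v : Ray m) :
    levelMap g (levelMap h v) = levelMap (g * h) v := by
  by_cases hv : ∃ p, IsNonzeroPos v k p
  · obtain ⟨p, hp⟩ := hv
    rw [levelMap_of_pos h hp, levelMap_of_pos (g * h) hp,
      levelMap_of_pos g (isNonzeroPos_applyAt _ hp),
      nonzeroPrefix_congr hp fun i hi => applyAt_of_lt _ v p hp.1 hi]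
    exact applyAt_mul _ _ v p hp.1
  · rw [levelMap_of_not h hv, levelMap_of_not g hv, levelMap_of_not (g * h) hv]

/-- `levelMap g` as a permutation of the rays; it is multiplicative in `g`. -/
noncomputable def levelHom (m k : ℕ) [NeZero m] :
    ((Fin k → Fin m) → TwoLevelAut m) →* Equiv.Perm (Ray m) where
  toFun g :=
    { toFun := levelMap g
      invFun := levelMap g⁻¹
      left_inv := fun v => by rw [levelMap_mul, inv_mul_cancel, levelMap_one]
      right_inv := fun v => by rw [levelMap_mul, mul_inv_cancel, levelMap_one] }
  map_one' := Equiv.ext levelMap_one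
  map_mul' g h := Equiv.ext fun v => (levelMap_mul g h v).symm

open Classical in
/-- The permutation `λ_{w,σ}`, for a word `w` of `k` nonzero letters: if the first `k` nonzero
letters agree with `w`, then it permutes the `(k+1)`-st nonzero letter and the following letter
by `σ`; otherwise it does nothing. -/
noncomputable def lambdaPerm {m k : ℕ} [NeZero m] (w : Fin k → NonzeroLetter m)
    (σ : TwoLevelAut m) : Equiv.Perm (Ray m) :=
  levelHom m k fun u => if u = fun j => (w j : Fin m) then σ else 1

/-- The group generated by the `λ_{w,σ}` for a given word `w`. -/
noncomputable def wordSubgroup {m k : ℕ} [NeZero m] (w : Fin k → NonzeroLetter m) :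
    Subgroup (Equiv.Perm (Ray m)) :=
  Subgroup.closure (Set.range (lambdaPerm w))

/-- The permutation of the rays that permutes the first letter by `σ`. -/
def firstLetterPerm (m : ℕ) : Equiv.Perm (Fin m) →* Equiv.Perm (Ray m) where
  toFun σ :=
    { toFun := fun v i => if i = 0 then σ (v i) else v i
      invFun := fun v i => if i = 0 then σ⁻¹ (v i) else v i
      left_inv := fun v => by funext i; by_cases h : i = 0 <;> simp [h]
      right_inv := fun v => by funext i; by_cases h : i = 0 <;> simp [h] }
  map_one' := by ext v i; simp
  map_mul' σ τ := by
    ext v i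
    by_cases h : i = 0 <;> simp [h]

/-- The level subgroups, with the index shifted by one: `levelSubgroup m 0` is the group
`L_{-1} = Sym(m)` permuting the first letter, and `levelSubgroup m (k + 1)` is the group `L_k`
generated by the `wordSubgroup w` for all words `w` of `k` nonzero letters. -/
noncomputable def levelSubgroup (m : ℕ) [NeZero m] : ℕ → Subgroup (Equiv.Perm (Ray m))
  | 0 => (firstLetterPerm m).range
  | k + 1 => ⨆ w : Fin k → NonzeroLetter m, wordSubgroup w

theorem finite_levelSubgroup (m : ℕ) [NeZero m] (j : ℕ) : Finite (levelSubgroup m j) := by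
  cases j with
  | zero => exact Set.finite_range (firstLetterPerm m)
  | succ k =>
    have hle : levelSubgroup m (k + 1) ≤ (levelHom m k).range := by
      refine iSup_le fun w => (Subgroup.closure_le _).2 ?_
      rintro _ ⟨σ, rfl⟩
      exact ⟨_, rfl⟩
    have hfin : Finite (levelHom m k).range := Set.finite_range (levelHom m k)
    exact Finite.of_injective _ (Subgroup.inclusion_injective hle)

/-! ### Fractal mother graphs -/

/-- The generators of the mother group of degree `d`: the elements of `L_{-1}, L_0, …, L_d`,
counted with multiplicity (an element lying in several of these groups is counted once for each
of them). -/
abbrev MotherGenerator (d m : ℕ) [NeZero m] := Σ j : Fin (d + 2), levelSubgroup m j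

noncomputable instance (d m : ℕ) [NeZero m] : Fintype (MotherGenerator d m) :=
  haveI := fun j : Fin (d + 2) => finite_levelSubgroup m j
  Fintype.ofFinite _

instance (d m : ℕ) [NeZero m] : Nonempty (MotherGenerator d m) := ⟨⟨0, 1⟩⟩

/-- The generators of the mother group, acting on the boundary of the `m`-ary tree. -/
def motherAction (d m : ℕ) [NeZero m] : MotherGenerator d m → Equiv.Perm (Ray m) :=
  fun g => g.2.1

/-- The infinite fractal mother graph `𝒢(d, m, ∞)`: the connected component of the zero ray in the
Schreier graph of the action on the boundary with the generators `MotherGenerator d m`. -/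
def fractalMotherGraph (d m : ℕ) [NeZero m] :
    MotherGenerator d m → Equiv.Perm (schreierComponent (motherAction d m) (zeroRay m)) :=
  schreierRestrict (motherAction d m) (zeroRay m)

/-!
A vertex with finite effective resistance to infinity is visited finitely often. For the zero ray,
this resistance is bounded by climbing through larger and larger copies of the finite mother graphs
on the words of length `n`. The cost is a multiple of `∑ r n`, where `r n` is the resistance between
the uniform distributions on two neighbouring copies, whose words are followed by different letters.

The sum converges because `r n` decays polynomially. Of the `n` letters, the last `k`, where `m ^ k`
is of order `n`, are changed one by one along a Gray code path, which has at most `2 ^ k` edges. The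
earlier letters may meanwhile form any word with at most `d - 1` nonzero letters. As there are about
`n ^ (d - 1)` such words, this yields a bundle of parallel paths of resistance
`2 ^ k * n ^ (1 - d)`. The resistance of the flow that spreads from these sparse words to all words
is controlled by the `r j` with `j < n`, and is divided by `m ^ k` since it takes place in `m ^ k`
disjoint copies.
-/

open Function (HasFiniteSupport)
open scoped BigOperators

/-! ### Energy and transience -/

section Energy

variable {ι X : Type*} [Fintype ι] (s : ι → Equiv.Perm X)

/-- The contribution of the edges leaving `x` to the Dirichlet energy of `f`. -/
def energyDensity (f : X → ℝ) (x : X) : ℝ :=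
  ∑ i, (f (s i x) - f x) ^ 2

/-- The transition operator of the simple random walk on the Schreier graph of `s`. -/
noncomputable def transitionOp : Module.End ℝ (X → ℝ) :=
  (Fintype.card ι : ℝ)⁻¹ • ∑ i, LinearMap.funLeft ℝ ℝ (s i)

theorem transitionOp_apply (f : X → ℝ) (x : X) :
    transitionOp s f x = (Fintype.card ι : ℝ)⁻¹ * ∑ i, f (s i x) := by
  simp [transitionOp, LinearMap.funLeft]

theorem energyDensity_nonneg (f : X → ℝ) (x : X) : 0 ≤ energyDensity s f x :=
  Finset.sum_nonneg fun _ _ => sq_nonneg _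

variable {f : X → ℝ}

@[fun_prop]
theorem hasFiniteSupport_fun_sq (hf : HasFiniteSupport f) : HasFiniteSupport fun x => f x ^ 2 :=
  hf.fun_comp (zero_pow two_ne_zero)

theorem hasFiniteSupport_energyDensity (hf : HasFiniteSupport f) :
    HasFiniteSupport (energyDensity s f) := by
  unfold energyDensity
  fun_prop (disch := exact Equiv.injective _)

theorem hasFiniteSupport_transitionOp (hf : HasFiniteSupport f) :
    HasFiniteSupport (transitionOp s f) := by
  rw [funext (transitionOp_apply s f)]
  fun_prop (disch := exact Equiv.injective _)

theorem hasFiniteSupport_transitionOp_pow (hf : HasFiniteSupport f) (n : ℕ) :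
    HasFiniteSupport ((transitionOp s ^ n) f) := by
  induction n with
  | zero => exact hf
  | succ n ih => rw [pow_succ']; exact hasFiniteSupport_transitionOp s ih

theorem transitionOp_pow_nonneg (hf : 0 ≤ f) (n : ℕ) : 0 ≤ (transitionOp s ^ n) f := by
  induction n with
  | zero => exact hf
  | succ n ih =>
    intro x
    rw [pow_succ', Module.End.mul_apply, transitionOp_apply]
    exact mul_nonneg (by positivity) (Finset.sum_nonneg fun i _ => ih _)

theorem sq_sub_le_finsum_energyDensity (hf : HasFiniteSupport f) (x : X) (i : ι) :
    (f (s i x) - f x) ^ 2 ≤ ∑ᶠ z, energyDensity s f z :=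
  calc (f (s i x) - f x) ^ 2
      ≤ energyDensity s f x :=
        Finset.single_le_sum (f := fun i => (f (s i x) - f x) ^ 2) (fun _ _ => sq_nonneg _)
          (Finset.mem_univ i)
    _ ≤ ∑ᶠ z, energyDensity s f z :=
        single_le_finsum x (hasFiniteSupport_energyDensity s hf) (energyDensity_nonneg s f)

theorem finsum_sq_sub_comp_perm (σ : Equiv.Perm X) (hf : HasFiniteSupport f) :
    ∑ᶠ x, (f (σ x) - f x) ^ 2 = 2 * ∑ᶠ x, f x * (f x - f (σ x)) := by
  have hinv : ∑ᶠ x, f (σ x) ^ 2 = ∑ᶠ x, f x ^ 2 := finsum_comp_equiv σ (f := fun x => f x ^ 2)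
  calc ∑ᶠ x, (f (σ x) - f x) ^ 2
      = ∑ᶠ x, (f (σ x) ^ 2 - f x ^ 2 + 2 * (f x * (f x - f (σ x)))) :=
        finsum_congr fun x => by ring
    _ = ∑ᶠ x, f (σ x) ^ 2 - ∑ᶠ x, f x ^ 2 + 2 * ∑ᶠ x, f x * (f x - f (σ x)) := by
        rw [finsum_add_distrib (by fun_prop (disch := exact σ.injective)) (by fun_prop),
          finsum_sub_distrib (by fun_prop (disch := exact σ.injective)) (by fun_prop), mul_finsum]
    _ = 2 * ∑ᶠ x, f x * (f x - f (σ x)) := by rw [hinv, sub_self, zero_add]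

theorem finsum_energyDensity [Nonempty ι] (hf : HasFiniteSupport f) :
    ∑ᶠ x, energyDensity s f x =
      2 * Fintype.card ι * ∑ᶠ x, f x * (f x - transitionOp s f x) := by
  have hcard : (Fintype.card ι : ℝ) ≠ 0 := by exact_mod_cast Fintype.card_ne_zero
  calc ∑ᶠ x, energyDensity s f x
      = ∑ i, ∑ᶠ x, (f (s i x) - f x) ^ 2 :=
        finsum_sum_comm _ _ fun i _ => by fun_prop (disch := exact (s i).injective)
    _ = 2 * ∑ᶠ x, ∑ i, f x * (f x - f (s i x)) := by
        rw [Finset.sum_congr rfl fun i _ => finsum_sq_sub_comp_perm (s i) hf, ← Finset.mul_sum,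
          finsum_sum_comm _ _ fun i _ => by fun_prop]
    _ = 2 * ∑ᶠ x, Fintype.card ι * (f x * (f x - transitionOp s f x)) := by
        congr 1
        refine finsum_congr fun x => ?_
        rw [transitionOp_apply, ← Finset.mul_sum, Finset.sum_sub_distrib, Finset.sum_const,
          nsmul_eq_mul, Finset.card_univ]
        field_simp
    _ = 2 * Fintype.card ι * ∑ᶠ x, f x * (f x - transitionOp s f x) := by
        rw [← mul_finsum, mul_assoc]

end Energy

section Resistance

variable {ι X : Type*} [Fintype ι] {s : ι → Equiv.Perm X} {x y : X} {C D : ℝ}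

/-- Every finitely supported `f` satisfies `f x ^ 2 ≤ C * E(f)`, where `E` is the Dirichlet energy.
Up to normalization, this says that the effective resistance between `x` and infinity is at most
`C`. -/
def ResistanceToInftyLE (s : ι → Equiv.Perm X) (x : X) (C : ℝ) : Prop :=
  ∀ f : X → ℝ, HasFiniteSupport f → f x ^ 2 ≤ C * ∑ᶠ z, energyDensity s f z

open Classical in
theorem hasFiniteSupport_single (y : X) : HasFiniteSupport (Pi.single y (1 : ℝ)) :=
  (Set.finite_singleton y).subset Pi.support_single_subset

open Classical in
theorem single_one_nonneg (y : X) : (0 : X → ℝ) ≤ Pi.single y 1 :=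
  Pi.single_nonneg.2 zero_le_one

open Classical in
theorem ResistanceToInftyLE.pos (h : ResistanceToInftyLE s x C) : 0 < C := by
  have hle := h _ (hasFiniteSupport_single x)
  have hE := finsum_nonneg (energyDensity_nonneg s (Pi.single x 1))
  rw [Pi.single_eq_same] at hle
  by_contra! hC
  linarith [mul_nonpos_of_nonpos_of_nonneg hC hE]

theorem ResistanceToInftyLE.of_adj (h : ResistanceToInftyLE s x C) (hxy : (schreierAdj s).Adj x y) :
    ResistanceToInftyLE s y (2 * C + 2) := by
  intro f hf
  have hedge : (f y - f x) ^ 2 ≤ ∑ᶠ z, energyDensity s f z := by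
    obtain ⟨_, ⟨i, rfl⟩ | ⟨i, rfl⟩⟩ := hxy
    · exact sq_sub_le_finsum_energyDensity s hf x i
    · rw [sub_sq_comm]
      exact sq_sub_le_finsum_energyDensity s hf y i
  linarith [h f hf, sq_nonneg (f y - 2 * f x)]

theorem ResistanceToInftyLE.exists_of_reachable (h : ResistanceToInftyLE s x C)
    (hxy : (schreierAdj s).Reachable x y) : ∃ D, ResistanceToInftyLE s y D := by
  rw [SimpleGraph.reachable_iff_reflTransGen] at hxy
  induction hxy with
  | refl => exact ⟨C, h⟩
  | tail _ hadj ih =>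
    obtain ⟨D, hD⟩ := ih
    exact ⟨2 * D + 2, hD.of_adj hadj⟩

open Classical in
/-- The expected number of visits to `y` before time `N`, as a function of the starting vertex. -/
noncomputable def greenSum (s : ι → Equiv.Perm X) (y : X) (N : ℕ) : X → ℝ :=
  ∑ n ∈ Finset.range N, (transitionOp s ^ n) (Pi.single y 1)

theorem greenSum_nonneg (y : X) (N : ℕ) : 0 ≤ greenSum s y N :=
  Finset.sum_nonneg fun n _ => transitionOp_pow_nonneg s (single_one_nonneg y) n

theorem hasFiniteSupport_greenSum (y : X) (N : ℕ) : HasFiniteSupport (greenSum s y N) := by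
  classical
  have h := hasFiniteSupport_transitionOp_pow s (hasFiniteSupport_single y)
  rw [greenSum, Finset.sum_fn]
  fun_prop

open Classical in
theorem greenSum_sub_transitionOp_greenSum (y : X) (N : ℕ) :
    greenSum s y N - transitionOp s (greenSum s y N) =
      Pi.single y 1 - (transitionOp s ^ N) (Pi.single y 1) := by
  have h := Finset.sum_range_sub' (fun n => (transitionOp s ^ n) (Pi.single y 1)) N
  rw [greenSum, map_sum, ← Finset.sum_sub_distrib]
  simpa only [pow_succ', Module.End.mul_apply, pow_zero, Module.End.one_apply] using h

theorem finsum_energyDensity_greenSum_le [Nonempty ι] (y : X) (N : ℕ) :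
    ∑ᶠ z, energyDensity s (greenSum s y N) z ≤ 2 * Fintype.card ι * greenSum s y N y := by
  classical
  set g := greenSum s y N
  have hg : HasFiniteSupport g := hasFiniteSupport_greenSum y N
  rw [finsum_energyDensity s hg]
  gcongr
  calc ∑ᶠ z, g z * (g z - transitionOp s g z)
      ≤ ∑ᶠ z, g z * (Pi.single y 1 : X → ℝ) z := by
        refine finsum_le_finsum' (by fun_prop) (by fun_prop) fun z => ?_
        refine mul_le_mul_of_nonneg_left ?_ (greenSum_nonneg y N z)
        have hz := congrFun (greenSum_sub_transitionOp_greenSum (s := s) y N) z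
        have hpow := transitionOp_pow_nonneg s (single_one_nonneg y) N z
        simp only [Pi.sub_apply, Pi.zero_apply] at hz hpow
        linarith
    _ = g y := by
        rw [finsum_eq_single _ y fun z hz => by rw [Pi.single_eq_of_ne hz, mul_zero],
          Pi.single_eq_same, mul_one]

theorem ResistanceToInftyLE.greenSum_self_le [Nonempty ι] (h : ResistanceToInftyLE s y D) (N : ℕ) :
    greenSum s y N y ≤ D * (2 * Fintype.card ι) := by
  have hsq : greenSum s y N y * greenSum s y N y ≤ D * (2 * Fintype.card ι) * greenSum s y N y :=
    calc greenSum s y N y * greenSum s y N y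
        = greenSum s y N y ^ 2 := (sq _).symm
      _ ≤ D * ∑ᶠ z, energyDensity s (greenSum s y N) z := h _ (hasFiniteSupport_greenSum y N)
      _ ≤ D * (2 * Fintype.card ι * greenSum s y N y) :=
          mul_le_mul_of_nonneg_left (finsum_energyDensity_greenSum_le y N) h.pos.le
      _ = D * (2 * Fintype.card ι) * greenSum s y N y := (mul_assoc _ _ _).symm
  have hD := h.pos
  rcases (greenSum_nonneg (s := s) y N y).eq_or_lt with h0 | hpos
  · rw [← h0]
    exact (by positivity : (0 : ℝ) ≤ D * (2 * Fintype.card ι))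
  · exact le_of_mul_le_mul_right hsq hpos

theorem ResistanceToInftyLE.greenSum_sq_le [Nonempty ι] (hx : ResistanceToInftyLE s x C)
    (hy : ResistanceToInftyLE s y D) (N : ℕ) :
    greenSum s y N x ^ 2 ≤ C * (2 * Fintype.card ι * (D * (2 * Fintype.card ι))) :=
  calc greenSum s y N x ^ 2
      ≤ C * ∑ᶠ z, energyDensity s (greenSum s y N) z := hx _ (hasFiniteSupport_greenSum y N)
    _ ≤ C * (2 * Fintype.card ι * greenSum s y N y) :=
        mul_le_mul_of_nonneg_left (finsum_energyDensity_greenSum_le y N) hx.pos.le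
    _ ≤ C * (2 * Fintype.card ι * (D * (2 * Fintype.card ι))) := by
        have := hx.pos
        have := hy.greenSum_self_le N
        gcongr

open Classical in
theorem ResistanceToInftyLE.summable_transitionOp_pow [Nonempty ι] (hx : ResistanceToInftyLE s x C)
    (hy : ResistanceToInftyLE s y D) :
    Summable fun n => (transitionOp s ^ n) (Pi.single y 1) x := by
  refine summable_of_sum_range_le (c := √(C * (2 * Fintype.card ι * (D * (2 * Fintype.card ι)))))
    (fun n => transitionOp_pow_nonneg s (single_one_nonneg y) n x) fun N => ?_
  refine Real.le_sqrt_of_sq_le ((le_of_eq ?_).trans (hx.greenSum_sq_le hy N))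
  rw [greenSum, Finset.sum_apply]

end Resistance

/-! ### The law of the walk -/

section Law

variable {ι V : Type*}

theorem dependsOn_schreierWalk (s : ι → Equiv.Perm V) (x : V) (n : ℕ) :
    DependsOn (fun ω => schreierWalk s x ω n) (Finset.range n) := by
  intro ω ω' h
  induction n with
  | zero => rfl
  | succ n ih =>
    have hlt : ∀ k ∈ (Finset.range n : Set ℕ), ω k = ω' k := fun k hk =>
      h k (Finset.coe_subset.2 (Finset.range_subset_range.2 n.le_succ) hk)
    exact congrArg₂ (fun i z => s i z) (h n (Finset.mem_coe.2 (Finset.self_mem_range_succ n)))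
      (ih hlt)

theorem coe_schreierWalk_schreierRestrict (s : ι → Equiv.Perm V) (o : V)
    (x : schreierComponent s o) (ω : ℕ → ι) (n : ℕ) :
    (schreierWalk (schreierRestrict s o) x ω n).1 = schreierWalk s x ω n := by
  induction n with
  | zero => rfl
  | succ n ih => exact congrArg (s (ω n)) ih

theorem measurableSet_of_dependsOn [Finite ι] {P : (ℕ → ι) → Prop} {S : Finset ℕ}
    (hP : DependsOn P S) :
    MeasurableSet[@MeasurableSpace.pi ℕ (fun _ => ι) fun _ => ⊤] {ω | P ω} := by
  let _ : MeasurableSpace ι := ⊤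
  have : DiscreteMeasurableSpace ι := ⟨fun _ => trivial⟩
  obtain ⟨Q, rfl⟩ := dependsOn_iff_exists_comp.1 hP
  exact (MeasurableSet.of_discrete (s := {v | Q v})).preimage
    (measurable_pi_lambda _ fun k => measurable_pi_apply (k : ℕ))

variable [Fintype ι]

open Classical in
theorem transitionOp_pow_succ_single (s : ι → Equiv.Perm V) (x y : V) (n : ℕ) :
    (transitionOp s ^ (n + 1)) (Pi.single y 1) x =
      ∑ i, (transitionOp s ^ n) (Pi.single ((s i)⁻¹ y) 1) x * (Fintype.card ι : ℝ)⁻¹ := by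
  have hsingle : transitionOp s (Pi.single y (1 : ℝ)) =
      (Fintype.card ι : ℝ)⁻¹ • ∑ i, Pi.single ((s i)⁻¹ y) (1 : ℝ) := by
    funext z
    simp [transitionOp_apply, Pi.single_apply, Equiv.eq_symm_apply]
  rw [pow_succ, Module.End.mul_apply, hsingle, map_smul, map_sum, Pi.smul_apply,
    Finset.sum_apply, smul_eq_mul, mul_comm, Finset.sum_mul]

variable [Nonempty ι]

theorem uniformLabels_setOf_apply_eq (n : ℕ) (i : ι) :
    uniformLabels ι {ω | ω n = i} = (Fintype.card ι : ENNReal)⁻¹ := by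
  let _ : MeasurableSpace ι := ⊤
  have : DiscreteMeasurableSpace ι := ⟨fun _ => trivial⟩
  have heval := measurePreserving_eval_infinitePi
    (fun _ : ℕ => (PMF.uniformOfFintype ι).toMeasure) n
  calc uniformLabels ι {ω | ω n = i}
      = (PMF.uniformOfFintype ι).toMeasure {i} :=
        heval.measure_preimage (MeasurableSet.of_discrete (s := {i})).nullMeasurableSet
    _ = (Fintype.card ι : ENNReal)⁻¹ := by
        rw [PMF.toMeasure_apply_singleton _ _ MeasurableSet.of_discrete,
          PMF.uniformOfFintype_apply]

theorem uniformLabels_inter_of_dependsOn {P Q : (ℕ → ι) → Prop} {S T : Finset ℕ}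
    (hP : DependsOn P S) (hQ : DependsOn Q T) (hST : Disjoint S T) :
    uniformLabels ι ({ω | P ω} ∩ {ω | Q ω}) =
      uniformLabels ι {ω | P ω} * uniformLabels ι {ω | Q ω} := by
  let _ : MeasurableSpace ι := ⊤
  have : DiscreteMeasurableSpace ι := ⟨fun _ => trivial⟩
  obtain ⟨P, rfl⟩ := dependsOn_iff_exists_comp.1 hP
  obtain ⟨Q, rfl⟩ := dependsOn_iff_exists_comp.1 hQ
  have hindep := (ProbabilityTheory.iIndepFun_infinitePi (Ω := fun _ : ℕ => ι)
    (P := fun _ : ℕ => (PMF.uniformOfFintype ι).toMeasure) (X := fun _ a => a)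
    (fun _ => measurable_id)).indepFun_finset S T hST fun k => measurable_pi_apply k
  exact hindep.measure_inter_preimage_eq_mul {v | P v} {v | Q v} MeasurableSet.of_discrete
    MeasurableSet.of_discrete

theorem uniformLabels_schreierWalk_succ (s : ι → Equiv.Perm V) (x y : V) (n : ℕ) :
    uniformLabels ι {ω | schreierWalk s x ω (n + 1) = y} =
      ∑ i, uniformLabels ι {ω | schreierWalk s x ω n = (s i)⁻¹ y} *
        (Fintype.card ι : ENNReal)⁻¹ := by
  have hwalk (z : V) : DependsOn (fun ω => schreierWalk s x ω n = z) (Finset.range n) :=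
    fun _ _ h => congrArg (· = z) (dependsOn_schreierWalk s x n h)
  have hlabel (i : ι) : DependsOn (fun ω : ℕ → ι => ω n = i) ({n} : Finset ℕ) :=
    fun _ _ h => congrArg (· = i) (h n (by simp))
  have hsplit : {ω | schreierWalk s x ω (n + 1) = y} = ⋃ i ∈ (Finset.univ : Finset ι),
      ({ω | schreierWalk s x ω n = (s i)⁻¹ y} ∩ {ω | ω n = i}) := by
    ext ω
    simp [schreierWalk, Equiv.eq_symm_apply]
  rw [hsplit, measure_biUnion_finset]
  · refine Finset.sum_congr rfl fun i _ => ?_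
    rw [uniformLabels_inter_of_dependsOn (hwalk _) (hlabel i) (by simp),
      uniformLabels_setOf_apply_eq]
  · exact fun i _ j _ hij => Set.disjoint_left.2 fun ω hi hj => hij (hi.2.symm.trans hj.2)
  · exact fun i _ => (measurableSet_of_dependsOn (hwalk _)).inter
      (measurableSet_of_dependsOn (hlabel i))

open Classical in
theorem uniformLabels_schreierWalk_eq (s : ι → Equiv.Perm V) (x y : V) (n : ℕ) :
    uniformLabels ι {ω | schreierWalk s x ω n = y} =
      ENNReal.ofReal ((transitionOp s ^ n) (Pi.single y 1) x) := by
  induction n generalizing y with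
  | zero =>
    let _ : MeasurableSpace ι := ⊤
    have hprob : uniformLabels ι Set.univ = 1 := by
      rw [uniformLabels]
      exact measure_univ
    by_cases h : x = y <;> simp [schreierWalk, h, hprob]
  | succ n ih =>
    have hcard : (0 : ℝ) < Fintype.card ι := by exact_mod_cast Fintype.card_pos
    have hnonneg (z : V) : 0 ≤ (transitionOp s ^ n) (Pi.single z 1) x :=
      transitionOp_pow_nonneg s (single_one_nonneg z) n x
    rw [uniformLabels_schreierWalk_succ, transitionOp_pow_succ_single,
      ENNReal.ofReal_sum_of_nonneg fun i _ => mul_nonneg (hnonneg _) (by positivity)]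
    refine Finset.sum_congr rfl fun i _ => ?_
    rw [ih, ENNReal.ofReal_mul (hnonneg _), ENNReal.ofReal_inv_of_pos hcard, ENNReal.ofReal_natCast]

theorem ResistanceToInftyLE.isTransientSchreier {s : ι → Equiv.Perm V} {o : V} {C : ℝ}
    (h : ResistanceToInftyLE s o C) : IsTransientSchreier (schreierRestrict s o) := by
  classical
  intro x y
  have hreach (z : schreierComponent s o) : (schreierAdj s).Reachable o z :=
    (SimpleGraph.ConnectedComponent.exact z.2).symm
  obtain ⟨C₁, hx⟩ := h.exists_of_reachable (hreach x)
  obtain ⟨C₂, hy⟩ := h.exists_of_reachable (hreach y)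
  have hlaw (n : ℕ) : uniformLabels ι {ω | schreierWalk (schreierRestrict s o) x ω n = y} =
      ENNReal.ofReal ((transitionOp s ^ n) (Pi.single (y : V) 1) x) := by
    simp only [Subtype.ext_iff, coe_schreierWalk_schreierRestrict, uniformLabels_schreierWalk_eq]
  refine ae_finite_setOfPred_mem
    (s := fun n => {ω | schreierWalk (schreierRestrict s o) x ω n = y}) ?_
  simp only [hlaw]
  exact (hx.summable_transitionOp_pow hy).tsum_ofReal_ne_top

end Law

/-! ### Energy majorants and words -/

/-- `e` majorizes the energy of `f` at every vertex of `G`, edge by edge. -/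
structure EnergyMajorant {X : Type*} (G : SimpleGraph X) (f e : X → ℝ) : Prop where
  nonneg : ∀ x, 0 ≤ e x
  sq_sub_le : ∀ ⦃x y⦄, G.Adj x y → (f x - f y) ^ 2 ≤ e x

namespace EnergyMajorant

variable {X : Type*} {G : SimpleGraph X} {f e : X → ℝ} {x y : X}

theorem of_eq_or_adj (h : EnergyMajorant G f e) (hxy : x = y ∨ G.Adj x y) :
    (f x - f y) ^ 2 ≤ e x := by
  obtain rfl | hxy := hxy
  · simpa using h.nonneg x
  · exact h.sq_sub_le hxy

theorem sq_sub_le_of_isPath (h : EnergyMajorant G f e) {p : G.Walk x y} (hp : p.IsPath)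
    {A : Finset X} (hA : ∀ z ∈ p.support, z ∈ A) :
    (f x - f y) ^ 2 ≤ p.length * ∑ z ∈ A, e z := by
  classical
  have hinj : Set.InjOn p.getVert (Finset.range p.length) :=
    hp.getVert_injOn.mono fun i hi => (Finset.mem_range.1 hi).le
  calc (f x - f y) ^ 2
      = (∑ i ∈ Finset.range p.length, (f (p.getVert i) - f (p.getVert (i + 1)))) ^ 2 := by
        rw [Finset.sum_range_sub' (fun i => f (p.getVert i)), p.getVert_zero, p.getVert_length]
    _ ≤ p.length * ∑ i ∈ Finset.range p.length,
          (f (p.getVert i) - f (p.getVert (i + 1))) ^ 2 := by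
        simpa using sq_sum_le_card_mul_sum_sq (s := Finset.range p.length)
          (f := fun i => f (p.getVert i) - f (p.getVert (i + 1)))
    _ ≤ p.length * ∑ i ∈ Finset.range p.length, e (p.getVert i) := by
        gcongr with i hi
        exact h.sq_sub_le (p.adj_getVert_succ (Finset.mem_range.1 hi))
    _ = p.length * ∑ z ∈ (Finset.range p.length).image p.getVert, e z := by
        rw [Finset.sum_image hinj]
    _ ≤ p.length * ∑ z ∈ A, e z := by
        gcongr
        · exact fun z _ _ => h.nonneg z
        · exact Finset.image_subset_iff.2 fun i _ => hA _ (p.getVert_mem_support i)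

theorem sq_sub_le_of_walk (h : EnergyMajorant G f e) (p : G.Walk x y) {A : Finset X}
    (hA : ∀ z ∈ p.support, z ∈ A) : (f x - f y) ^ 2 ≤ p.length * ∑ z ∈ A, e z := by
  classical
  refine (h.sq_sub_le_of_isPath p.bypass_isPath fun z hz =>
    hA z (p.support_bypass_subset_support hz)).trans ?_
  gcongr
  · exact Finset.sum_nonneg fun z _ => h.nonneg z
  · exact p.length_bypass_le_length

end EnergyMajorant

section Words

variable {α : Type*} [Finite α]

/-- The words of length `n`. -/
noncomputable def words (α : Type*) [Finite α] (n : ℕ) : Finset (List α) :=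
  (List.finite_length_eq α n).toFinset

@[simp]
theorem mem_words {n : ℕ} {y : List α} : y ∈ words α n ↔ y.length = n := by
  simp [words]

@[simp]
theorem words_zero : words α 0 = {[]} := by
  ext y
  simp

theorem nonempty_words (α : Type*) [Finite α] [Nonempty α] (n : ℕ) : (words α n).Nonempty :=
  ⟨List.replicate n (Classical.arbitrary α), by simp⟩

theorem sum_words_add {M : Type*} [AddCommMonoid M] (p k : ℕ) (φ : List α → M) :
    ∑ y ∈ words α (p + k), φ y = ∑ z ∈ words α k, ∑ y ∈ words α p, φ (y ++ z) := by
  rw [Finset.sum_sigma']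
  refine Finset.sum_nbij' (fun y => ⟨y.drop p, y.take p⟩) (fun zy => zy.2 ++ zy.1) ?_ ?_ ?_ ?_ ?_
  · simp +contextual
  · simp +contextual
  · simp
  · rintro ⟨z, y⟩ h
    simp only [Finset.mem_sigma, mem_words] at h
    simp [← h.2]
  · simp

theorem sum_words_one {M : Type*} [AddCommMonoid M] [Fintype α] (φ : List α → M) :
    ∑ z ∈ words α 1, φ z = ∑ c, φ [c] := by
  refine (Finset.sum_nbij (fun c => [c]) ?_ ?_ ?_ ?_).symm
  · simp
  · simp [Set.InjOn]
  · intro y hy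
    simpa [List.length_eq_one_iff, eq_comm] using hy
  · simp

theorem sum_words_succ {M : Type*} [AddCommMonoid M] [Fintype α] (p : ℕ) (φ : List α → M) :
    ∑ y ∈ words α (p + 1), φ y = ∑ c, ∑ y ∈ words α p, φ (y ++ [c]) := by
  rw [sum_words_add, sum_words_one]

theorem card_words (α : Type*) [Fintype α] (n : ℕ) :
    (words α n).card = Fintype.card α ^ n := by
  induction n with
  | zero => simp
  | succ n ih => rw [Finset.card_eq_sum_ones, sum_words_succ]; simp [ih, pow_succ']

/-- The words `y b 0 ⋯ 0` of length `p + 1` with `y` of length `i` form disjoint sets as `i`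
varies. -/
theorem sum_sum_words_append_le [Zero α] {b : α} (hb : b ≠ 0) {ψ : List α → ℝ}
    (hψ : ∀ y, 0 ≤ ψ y) (p : ℕ) :
    ∑ i ∈ Finset.range (p + 1), ∑ y ∈ words α i, ψ (y ++ b :: List.replicate (p - i) 0) ≤
      ∑ y ∈ words α (p + 1), ψ y := by
  classical
  cases nonempty_fintype α
  induction p generalizing ψ with
  | zero =>
    rw [sum_words_succ]
    simpa using Finset.single_le_sum (f := fun c => ψ [c]) (fun c _ => hψ [c]) (Finset.mem_univ b)
  | succ p ih =>
    have hzero : ∑ i ∈ Finset.range (p + 1), ∑ y ∈ words α i,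
        ψ (y ++ b :: List.replicate (p + 1 - i) 0) ≤ ∑ y ∈ words α (p + 1), ψ (y ++ [0]) := by
      refine (Finset.sum_congr rfl fun i hi => Finset.sum_congr rfl fun y _ => ?_).trans_le
        (ih fun y => hψ (y ++ [0]))
      rw [Nat.sub_add_comm (Finset.mem_range_succ_iff.1 hi), List.replicate_succ']
      simp
    calc ∑ i ∈ Finset.range (p + 2), ∑ y ∈ words α i, ψ (y ++ b :: List.replicate (p + 1 - i) 0)
        ≤ ∑ y ∈ words α (p + 1), ψ (y ++ [0]) + ∑ y ∈ words α (p + 1), ψ (y ++ [b]) := by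
          rw [Finset.sum_range_succ]
          simpa using hzero
      _ = ∑ c ∈ {0, b}, ∑ y ∈ words α (p + 1), ψ (y ++ [c]) := by
          rw [Finset.sum_pair hb.symm]
      _ ≤ ∑ c, ∑ y ∈ words α (p + 1), ψ (y ++ [c]) :=
          Finset.sum_le_univ_sum_of_nonneg fun c => Finset.sum_nonneg fun y _ => hψ _
      _ = ∑ y ∈ words α (p + 2), ψ y := (sum_words_succ _ _).symm

end Words

section GrayGraph

variable {α : Type*} [Zero α] [DecidableEq α] {b : α} {a a' : ℕ} {u u' : List α}

/-- The words `u` that are empty, or consist of a word with at most `a` nonzero letters followed by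
the letter `b`. If `a ≤ d` and `b ≠ 0`, then the elements of the levels `L_{-1}, …, L_d` of the
mother group can change the letter following `u` in an arbitrary way. -/
def IsActivePrefix (a : ℕ) (b : α) (u : List α) : Prop :=
  u = [] ∨ ∃ v, v.countP (· ≠ 0) ≤ a ∧ u = v ++ [b]

theorem isActivePrefix_nil : IsActivePrefix a b [] :=
  Or.inl rfl

theorem isActivePrefix_append_singleton {v : List α} (hv : v.countP (· ≠ 0) ≤ a) :
    IsActivePrefix a b (v ++ [b]) :=
  Or.inr ⟨v, hv, rfl⟩

theorem IsActivePrefix.mono (h : IsActivePrefix a b u) (ha : a ≤ a') : IsActivePrefix a' b u :=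
  h.imp_right fun ⟨v, hv, hu⟩ => ⟨v, hv.trans ha, hu⟩

theorem IsActivePrefix.append (h : IsActivePrefix a b u) (h' : IsActivePrefix a' b u') :
    IsActivePrefix (a + a' + 1) b (u ++ u') := by
  obtain rfl | ⟨v', hv', rfl⟩ := h'
  · simpa using h.mono (by lia)
  · rw [← List.append_assoc]
    refine isActivePrefix_append_singleton ?_
    obtain rfl | ⟨v, hv, rfl⟩ := h
    · simpa using hv'.trans (by lia)
    · have hb : List.countP (· ≠ 0) [b] ≤ 1 := List.countP_le_length
      simp only [List.countP_append]
      lia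

theorem exists_isActivePrefix_length_eq (b : α) (k : ℕ) :
    ∃ u : List α, u.length = k ∧ IsActivePrefix 0 b u := by
  cases k with
  | zero => exact ⟨[], rfl, isActivePrefix_nil⟩
  | succ k =>
    exact ⟨List.replicate k 0 ++ [b], by simp,
      isActivePrefix_append_singleton (by simp [List.countP_replicate])⟩

/-- The relation of differing in at most one letter, which is the first one or follows the first
nonzero letter, the latter being `b`. -/
inductive GrayStep (b : α) : List α → List α → Prop
  | mk (u : List α) (c c' : α) (t : List α) (hu : IsActivePrefix 0 b u) :
      GrayStep b (u ++ c :: t) (u ++ c' :: t)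

/-- The graph with the edges given by `GrayStep b`. On the words of length `n` in the letters `0`
and `b` it is a path (in the order of the Gray code). -/
def grayGraph (b : α) : SimpleGraph (List α) :=
  SimpleGraph.fromRel (GrayStep b)

theorem GrayStep.append {z z' : List α} (h : GrayStep b z z') (t : List α) :
    GrayStep b (z ++ t) (z' ++ t) := by
  obtain ⟨u, c, c', s, hu⟩ := h
  simpa using GrayStep.mk u c c' (s ++ t) hu

theorem GrayStep.length_eq {z z' : List α} (h : GrayStep b z z') : z.length = z'.length := by
  obtain ⟨u, c, c', s, hu⟩ := h
  simp

theorem GrayStep.exists_walk_length_le_one {z z' : List α} (h : GrayStep b z z') :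
    ∃ p : (grayGraph b).Walk z z', p.length ≤ 1 := by
  by_cases hz : z = z'
  · subst hz
    exact ⟨.nil, zero_le_one⟩
  · exact ⟨(show (grayGraph b).Adj z z' from ⟨hz, Or.inl h⟩).toWalk, le_rfl⟩

theorem exists_grayGraph_walk_append {x y : List α} (p : (grayGraph b).Walk x y) (t : List α) :
    ∃ q : (grayGraph b).Walk (x ++ t) (y ++ t), q.length = p.length :=
  let φ : grayGraph b →g grayGraph b :=
    { toFun := (· ++ t)
      map_rel' := fun h => ⟨by simpa using h.1, h.2.imp (·.append t) (·.append t)⟩ }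
  ⟨p.map φ, p.length_map φ⟩

theorem length_eq_of_mem_support_grayGraph {x y : List α} (p : (grayGraph b).Walk x y) :
    ∀ z ∈ p.support, z.length = x.length := by
  induction p with
  | nil => simp
  | cons h p ih =>
    have hlen := h.2.elim GrayStep.length_eq fun h' => h'.length_eq.symm
    simpa [hlen] using ih

theorem exists_grayGraph_walk (b : α) {k : ℕ} {z z' : List α} (hz : z.length = k)
    (hz' : z'.length = k) : ∃ p : (grayGraph b).Walk z z', p.length < 2 ^ k := by
  induction k generalizing z z' with
  | zero =>
    obtain rfl := List.eq_nil_of_length_eq_zero hz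
    obtain rfl := List.eq_nil_of_length_eq_zero hz'
    exact ⟨.nil, by simp⟩
  | succ k ih =>
    obtain ⟨w, hw, hactive⟩ := exists_isActivePrefix_length_eq b k
    obtain ⟨u, c, rfl⟩ := List.eq_nil_or_concat' z |>.resolve_left (by rintro rfl; simp at hz)
    obtain ⟨u', c', rfl⟩ := List.eq_nil_or_concat' z' |>.resolve_left (by rintro rfl; simp at hz')
    obtain ⟨p, hp⟩ := ih (z := u) (by simpa using hz) hw
    obtain ⟨p', hp'⟩ := ih hw (z' := u') (by simpa using hz')
    obtain ⟨q, hq⟩ := exists_grayGraph_walk_append p [c]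
    obtain ⟨r, hr⟩ := (GrayStep.mk w c c' [] hactive).exists_walk_length_le_one
    obtain ⟨q', hq'⟩ := exists_grayGraph_walk_append p' [c']
    refine ⟨(q.append r).append q', ?_⟩
    rw [SimpleGraph.Walk.length_append, SimpleGraph.Walk.length_append, pow_succ]
    lia

theorem EnergyMajorant.sq_sub_le_sum_words [Finite α] {f e : List α → ℝ}
    (h : EnergyMajorant (grayGraph b) f e) {k : ℕ} {z z' : List α} (hz : z.length = k)
    (hz' : z'.length = k) : (f z - f z') ^ 2 ≤ 2 ^ k * ∑ w ∈ words α k, e w := by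
  obtain ⟨p, hp⟩ := exists_grayGraph_walk b hz hz'
  refine (h.sq_sub_le_of_walk p (A := words α k) fun w hw => ?_).trans ?_
  · rw [mem_words, length_eq_of_mem_support_grayGraph p w hw, hz]
  · gcongr
    · exact Finset.sum_nonneg fun w _ => h.nonneg w
    · exact_mod_cast hp.le

end GrayGraph

/-! ### Averages over sparse words -/

theorem sq_expect_le_sum_sq_div_card {ι : Type*} (s : Finset ι) (f : ι → ℝ) :
    (𝔼 i ∈ s, f i) ^ 2 ≤ (∑ i ∈ s, f i ^ 2) / s.card := by
  rw [Finset.expect_eq_sum_div_card]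
  exact sum_div_card_sq_le_sum_sq_div_card

/-- The set `{⌈p / 2⌉, …, p}`. -/
def upperHalf (p : ℕ) : Finset ℕ :=
  Finset.Ico ((p + 1) / 2) (p + 1)

theorem upperHalf_subset_range (p : ℕ) : upperHalf p ⊆ Finset.range (p + 1) := by
  rw [Finset.range_eq_Ico]
  exact Finset.Ico_subset_Ico_left (Nat.zero_le _)

theorem nonempty_upperHalf (p : ℕ) : (upperHalf p).Nonempty :=
  ⟨p, Finset.mem_Ico.2 (by lia)⟩

section SparseMean

variable {α : Type*} [Zero α]

/-- The mean of `φ` with respect to a probability measure on the words of length `p` in the letters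
`0` and `b` with at most `a` nonzero letters: the position of the last nonzero letter is uniform
in the upper half of the available positions, the position of the nonzero letter before it is
uniform in the upper half of the positions that remain, and so on. -/
noncomputable def sparseMean (b : α) : ℕ → ℕ → (List α → ℝ) → ℝ
  | 0, p, φ => φ (List.replicate p 0)
  | _ + 1, 0, φ => φ []
  | a + 1, p + 1, φ =>
    𝔼 i ∈ upperHalf p, sparseMean b a i fun y => φ (y ++ b :: List.replicate (p - i) 0)

theorem sparseMean_sub (b : α) (a p : ℕ) (φ ψ : List α → ℝ) :
    sparseMean b a p (fun y => φ y - ψ y) = sparseMean b a p φ - sparseMean b a p ψ := by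
  induction a generalizing p φ ψ with
  | zero => simp only [sparseMean]
  | succ a ih =>
    cases p with
    | zero => simp only [sparseMean]
    | succ p => simp only [sparseMean, ih, Finset.expect_sub_distrib]

variable [Finite α] [DecidableEq α]

/-- The words of length `n` with at most `a` nonzero letters. -/
noncomputable def sparseWords (α : Type*) [Finite α] [Zero α] [DecidableEq α] (a n : ℕ) :
    Finset (List α) :=
  {y ∈ words α n | y.countP (· ≠ 0) ≤ a}

theorem mem_sparseWords {a n : ℕ} {y : List α} :
    y ∈ sparseWords α a n ↔ y.length = n ∧ y.countP (· ≠ 0) ≤ a := by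
  simp [sparseWords]

theorem sparseWords_subset_words (a n : ℕ) : sparseWords α a n ⊆ words α n :=
  Finset.filter_subset _ _

theorem sum_sum_sparseWords_append_le {b : α} (hb : b ≠ 0) {ψ : List α → ℝ}
    (hψ : ∀ y, 0 ≤ ψ y) (a p : ℕ) :
    ∑ i ∈ Finset.range (p + 1), ∑ y ∈ sparseWords α a i,
      ψ (y ++ b :: List.replicate (p - i) 0) ≤ ∑ y ∈ sparseWords α (a + 1) (p + 1), ψ y := by
  classical
  let χ : List α → ℝ := fun y => if y.countP (· ≠ 0) ≤ a + 1 then ψ y else 0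
  have hχ : ∀ y, 0 ≤ χ y := fun y => by
    dsimp only [χ]
    split_ifs
    exacts [hψ y, le_rfl]
  simp only [sparseWords, Finset.sum_filter]
  refine le_of_eq_of_le ?_ (sum_sum_words_append_le hb hχ p)
  refine Finset.sum_congr rfl fun i _ => Finset.sum_congr rfl fun y _ => ?_
  simp [χ, List.countP_append, List.countP_replicate, hb]

/-- By duality, this means that `q` bounds the sum of the squares of the masses of the points for
the measure defining `sparseMean b a p`. -/
def SparseMassBound (b : α) (a p : ℕ) (q : ℝ) : Prop :=
  ∀ φ, sparseMean b a p φ ^ 2 ≤ q * ∑ y ∈ sparseWords α a p, φ y ^ 2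

theorem sq_apply_replicate_zero_le_sum_sparseWords (a p : ℕ) (φ : List α → ℝ) :
    φ (List.replicate p 0) ^ 2 ≤ ∑ y ∈ sparseWords α a p, φ y ^ 2 :=
  Finset.single_le_sum (f := fun y => φ y ^ 2) (fun y _ => sq_nonneg (φ y)) <|
    mem_sparseWords.2 ⟨List.length_replicate, by simp [List.countP_replicate]⟩

theorem sparseMassBound_zero_left (b : α) (p : ℕ) : SparseMassBound b 0 p 1 := fun φ => by
  simpa only [sparseMean, one_mul] using sq_apply_replicate_zero_le_sum_sparseWords 0 p φ

theorem sparseMassBound_zero_right (b : α) (a : ℕ) : SparseMassBound b a 0 1 := fun φ => by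
  cases a <;>
    simpa only [sparseMean, one_mul, List.replicate_zero] using
      sq_apply_replicate_zero_le_sum_sparseWords _ 0 φ

theorem SparseMassBound.succ {b : α} (hb : b ≠ 0) {a p : ℕ} {q : ℝ} (hq : 0 ≤ q)
    (h : ∀ i ∈ upperHalf p, SparseMassBound b a i q) :
    SparseMassBound b (a + 1) (p + 1) (q / (upperHalf p).card) := fun φ => by
  let φ' (i : ℕ) (y : List α) : ℝ := φ (y ++ b :: List.replicate (p - i) 0)
  calc sparseMean b (a + 1) (p + 1) φ ^ 2
      ≤ (∑ i ∈ upperHalf p, sparseMean b a i (φ' i) ^ 2) / (upperHalf p).card :=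
        sq_expect_le_sum_sq_div_card _ _
    _ ≤ (∑ i ∈ upperHalf p, q * ∑ y ∈ sparseWords α a i, φ' i y ^ 2) / (upperHalf p).card := by
        gcongr with i hi
        exact h i hi (φ' i)
    _ = q / (upperHalf p).card * ∑ i ∈ upperHalf p, ∑ y ∈ sparseWords α a i, φ' i y ^ 2 := by
        rw [← Finset.mul_sum, mul_div_right_comm]
    _ ≤ q / (upperHalf p).card *
          ∑ i ∈ Finset.range (p + 1), ∑ y ∈ sparseWords α a i, φ' i y ^ 2 := by
        gcongr
        exact upperHalf_subset_range p
    _ ≤ q / (upperHalf p).card * ∑ y ∈ sparseWords α (a + 1) (p + 1), φ y ^ 2 := by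
        gcongr
        exact sum_sum_sparseWords_append_le hb (fun y => sq_nonneg (φ y)) a p

end SparseMean

/-! ### Moves of the mother groups -/

section Moves

variable {m : ℕ}

/-- The ray obtained by writing the word `y` in front of `t`, so that it is read before `t`. -/
def appRay (y : List (Fin m)) (t : Ray m) : Ray m :=
  (y ++ₛ (t : Stream' (Fin m)) : Stream' (Fin m))

infixr:60 " ⊳ " => appRay

theorem append_appRay (y z : List (Fin m)) (t : Ray m) : (y ++ z) ⊳ t = y ⊳ z ⊳ t :=
  Stream'.append_append_stream y z t

theorem appRay_injOn_words (n : ℕ) (t : Ray m) : Set.InjOn (· ⊳ t) (words (Fin m) n) :=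
  fun y hy z hz h => Stream'.append_left_injective y z t t h <| by
    rw [mem_words.1 hy, mem_words.1 hz]

@[simp]
theorem nil_appRay (t : Ray m) : [] ⊳ t = t := rfl

@[simp]
theorem cons_appRay_zero (a : Fin m) (y : List (Fin m)) (t : Ray m) : ((a :: y) ⊳ t) 0 = a := rfl

@[simp]
theorem cons_appRay_succ (a : Fin m) (y : List (Fin m)) (t : Ray m) (i : ℕ) :
    ((a :: y) ⊳ t) (i + 1) = (y ⊳ t) i := rfl

theorem update_appRay (y : List (Fin m)) (c c' : Fin m) (t : Ray m) :
    Function.update ((y ++ [c]) ⊳ t) y.length c' = (y ++ [c']) ⊳ t := by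
  induction y with
  | nil =>
    funext i
    cases i <;> simp [Function.update]
  | cons a y ih =>
    funext i
    cases i with
    | zero => simp [Function.update]
    | succ i => simpa [Function.update] using congrFun ih i

variable [NeZero m]

theorem replicate_zero_appRay_zeroRay (n : ℕ) : List.replicate n 0 ⊳ zeroRay m = zeroRay m := by
  induction n with
  | zero => rfl
  | succ n ih =>
    funext i
    cases i with
    | zero => rfl
    | succ i => exact congrFun ih i

theorem isNonzeroPos_append_appRay (y : List (Fin m)) {b : Fin m} (hb : b ≠ 0) (t : Ray m) :
    IsNonzeroPos ((y ++ [b]) ⊳ t) (y.countP (· ≠ 0)) y.length := by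
  induction y with
  | nil => exact ⟨hb, Nat.count_zero _⟩
  | cons a y ih =>
    refine ⟨ih.1, ?_⟩
    rw [List.length_cons, Nat.count_succ', List.countP_cons]
    exact congrArg₂ (· + ·) ih.2 (by by_cases ha : a = 0 <;> simp [ha])

theorem exists_motherAction_update_zero (d : ℕ) (v : Ray m) (c : Fin m) :
    ∃ g, motherAction d m g v = Function.update v 0 c := by
  refine ⟨⟨0, firstLetterPerm m (Equiv.swap (v 0) c), ⟨_, rfl⟩⟩, ?_⟩
  funext i
  cases i <;> simp [motherAction, firstLetterPerm]

/-- The automorphism that acts by `τ` on the children of `b`, and fixes the other words. -/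
def childAut (b : Fin m) (τ : Equiv.Perm (Fin m)) : TwoLevelAut m :=
  ⟨(Equiv.refl (NonzeroLetter m)).prodShear fun x => if (x : Fin m) = b then τ else 1,
    fun _ _ => Iff.rfl⟩

theorem applyAt_childAut (τ : Equiv.Perm (Fin m)) (v : Ray m) (p : ℕ) (hp : v p ≠ 0) :
    applyAt (childAut (v p) τ) v p hp = Function.update v (p + 1) (τ (v (p + 1))) := by
  funext i
  obtain rfl | hp := eq_or_ne i p
  · simp [applyAt, childAut]
  · obtain rfl | hp' := eq_or_ne i (p + 1)
    · simp [applyAt, childAut]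
    · simp [applyAt, hp, hp']

theorem nonzeroPrefix_ne_zero {k : ℕ} {v : Ray m} {p : ℕ} (hv : IsNonzeroPos v k p) (j : Fin k) :
    nonzeroPrefix k v j ≠ 0 := by
  refine Nat.nth_mem (p := fun i => v i ≠ 0) j fun hf => ?_
  exact (hv.2 ▸ j.2 : (j : ℕ) < _).trans_le (Nat.count_le_card hf p)

theorem levelHom_apply {k : ℕ} (g : (Fin k → Fin m) → TwoLevelAut m) (v : Ray m) :
    levelHom m k g v = levelMap g v := rfl

theorem lambdaPerm_apply_of_isNonzeroPos {k : ℕ} (w : Fin k → NonzeroLetter m) (σ : TwoLevelAut m)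
    {v : Ray m} {p : ℕ} (hv : IsNonzeroPos v k p)
    (hw : nonzeroPrefix k v = fun j => (w j : Fin m)) :
    lambdaPerm w σ v = applyAt σ v p hv.1 := by
  rw [lambdaPerm, levelHom_apply, levelMap_of_pos _ hv, if_pos hw]

theorem exists_motherAction_update_succ {d k : ℕ} (hk : k ≤ d) {v : Ray m} {p : ℕ}
    (hv : IsNonzeroPos v k p) (c : Fin m) :
    ∃ g, motherAction d m g v = Function.update v (p + 1) c := by
  let w : Fin k → NonzeroLetter m := fun j => ⟨nonzeroPrefix k v j, nonzeroPrefix_ne_zero hv j⟩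
  let σ := childAut (v p) (Equiv.swap (v (p + 1)) c)
  have hmem : lambdaPerm w σ ∈ levelSubgroup m (k + 1) :=
    (le_iSup (fun w : Fin k → NonzeroLetter m => wordSubgroup w) w)
      (Subgroup.subset_closure ⟨σ, rfl⟩)
  refine ⟨⟨⟨k + 1, by lia⟩, lambdaPerm w σ, hmem⟩, ?_⟩
  change lambdaPerm w σ v = _
  rw [lambdaPerm_apply_of_isNonzeroPos w σ hv rfl, applyAt_childAut, Equiv.swap_apply_left]

theorem IsActivePrefix.exists_motherAction_appRay {d : ℕ} {b : Fin m} (hb : b ≠ 0)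
    {u : List (Fin m)} (hu : IsActivePrefix d b u) (c c' : Fin m) (t : Ray m) :
    ∃ g, motherAction d m g ((u ++ [c]) ⊳ t) = (u ++ [c']) ⊳ t := by
  rw [← update_appRay u c c']
  obtain rfl | ⟨v, hv, rfl⟩ := hu
  · exact exists_motherAction_update_zero d _ c'
  · have h := exists_motherAction_update_succ hv (isNonzeroPos_append_appRay v hb ([c] ⊳ t)) c'
    simpa only [append_appRay, List.length_append, List.length_singleton] using h

/-- The Schreier graph of the mother group acting on all the rays. -/
abbrev motherGraph (d m : ℕ) [NeZero m] : SimpleGraph (Ray m) :=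
  schreierAdj (motherAction d m)

theorem energyMajorant_energyDensity (d : ℕ) (f : Ray m → ℝ) :
    EnergyMajorant (motherGraph d m) f (energyDensity (motherAction d m) f) where
  nonneg := energyDensity_nonneg _ f
  sq_sub_le x y h := by
    obtain ⟨g, rfl⟩ : ∃ g, motherAction d m g x = y := by
      obtain ⟨-, h | ⟨g, rfl⟩⟩ := h
      · exact h
      · exact ⟨⟨g.1, g.2⁻¹⟩, (motherAction d m g).symm_apply_apply y⟩
    rw [sub_sq_comm]
    exact Finset.single_le_sum (f := fun g => (f (motherAction d m g x) - f x) ^ 2)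
      (fun _ _ => sq_nonneg _) (Finset.mem_univ g)

variable {d a : ℕ} {b : Fin m} {f e : Ray m → ℝ}

theorem EnergyMajorant.sq_sub_le_of_isActivePrefix (h : EnergyMajorant (motherGraph d m) f e)
    (hb : b ≠ 0) {u : List (Fin m)} (hu : IsActivePrefix d b u) (c c' : Fin m) (t : Ray m) :
    (f ((u ++ [c]) ⊳ t) - f ((u ++ [c']) ⊳ t)) ^ 2 ≤ e ((u ++ [c]) ⊳ t) := by
  refine h.of_eq_or_adj (or_iff_not_imp_left.2 fun hne => ⟨hne, Or.inl ?_⟩)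
  exact hu.exists_motherAction_appRay hb c c' t

theorem EnergyMajorant.grayGraph_append (h : EnergyMajorant (motherGraph d m) f e) (hb : b ≠ 0)
    {w : List (Fin m)} (hw : IsActivePrefix a b w) (ha : a + 1 ≤ d) (t : Ray m) :
    EnergyMajorant (grayGraph b) (fun z => f ((w ++ z) ⊳ t)) (fun z => e ((w ++ z) ⊳ t)) where
  nonneg _ := h.nonneg _
  sq_sub_le := by
    have hstep (u : List (Fin m)) (c c' : Fin m) (s : List (Fin m)) (hu : IsActivePrefix 0 b u) :
        (f ((w ++ (u ++ c :: s)) ⊳ t) - f ((w ++ (u ++ c' :: s)) ⊳ t)) ^ 2 ≤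
          e ((w ++ (u ++ c :: s)) ⊳ t) := by
      simpa [← append_appRay] using
        h.sq_sub_le_of_isActivePrefix hb ((hw.append hu).mono ha) c c' (s ⊳ t)
    rintro _ _ ⟨-, ⟨u, c, c', s, hu⟩ | ⟨u, c, c', s, hu⟩⟩ <;> exact hstep _ _ _ _ hu

end Moves

/-! ### Averages over cylinders -/

theorem sq_expect_sub_le {ι : Type*} {s : Finset ι} (hs : s.Nonempty) {f : ι → ℝ} {x C : ℝ}
    (h : ∀ i ∈ s, (f i - x) ^ 2 ≤ C) : (𝔼 i ∈ s, f i - x) ^ 2 ≤ C := by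
  calc (𝔼 i ∈ s, f i - x) ^ 2
      = (𝔼 i ∈ s, (f i - x)) ^ 2 := by rw [Finset.expect_sub_distrib, Finset.expect_const hs]
    _ ≤ 𝔼 i ∈ s, (f i - x) ^ 2 := by
        rw [Finset.expect_eq_sum_div_card s fun i => (f i - x) ^ 2]
        exact sq_expect_le_sum_sq_div_card s _
    _ ≤ C := Finset.expect_le hs h

theorem sq_sub_le_three_mul (x y z w : ℝ) :
    (x - w) ^ 2 ≤ 3 * ((x - y) ^ 2 + (y - z) ^ 2 + (z - w) ^ 2) := by
  linarith [sq_nonneg (x - y - (y - z)), sq_nonneg (y - z - (z - w)), sq_nonneg (x - y - (z - w))]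

section Cylinders

variable {m : ℕ}

/-- The sum of `e` over the rays obtained by writing a word of length `n` in front of `t`. -/
noncomputable def cylSum (e : Ray m → ℝ) (n : ℕ) (t : Ray m) : ℝ :=
  ∑ y ∈ words (Fin m) n, e (y ⊳ t)

/-- The mean of `f` over the rays obtained by writing a word of length `n` in front of `t`. -/
noncomputable def cylMean (f : Ray m → ℝ) (n : ℕ) (t : Ray m) : ℝ :=
  𝔼 y ∈ words (Fin m) n, f (y ⊳ t)

variable {f e : Ray m → ℝ}

theorem cylSum_nonneg (he : ∀ x, 0 ≤ e x) (n : ℕ) (t : Ray m) : 0 ≤ cylSum e n t :=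
  Finset.sum_nonneg fun _ _ => he _

theorem cylSum_add (e : Ray m → ℝ) (p k : ℕ) (t : Ray m) :
    cylSum e (p + k) t = ∑ z ∈ words (Fin m) k, cylSum e p (z ⊳ t) := by
  simp only [cylSum, sum_words_add, append_appRay]

theorem cylMean_add (f : Ray m → ℝ) (p k : ℕ) (t : Ray m) :
    cylMean f (p + k) t = 𝔼 z ∈ words (Fin m) k, cylMean f p (z ⊳ t) := by
  simp only [cylMean, Finset.expect_eq_sum_div_card, sum_words_add, append_appRay, card_words,
    ← Finset.sum_div]
  rw [div_div, pow_add, Nat.cast_mul]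

theorem cylSum_appRay_le (he : ∀ x, 0 ≤ e x) (p : ℕ) (z : List (Fin m)) (t : Ray m) :
    cylSum e p (z ⊳ t) ≤ cylSum e (p + z.length) t := by
  rw [cylSum_add]
  exact Finset.single_le_sum (f := fun z => cylSum e p (z ⊳ t))
    (fun z _ => cylSum_nonneg he p (z ⊳ t)) (mem_words.2 rfl)

theorem apply_appRay_le_cylSum (he : ∀ x, 0 ≤ e x) (y : List (Fin m)) (t : Ray m) :
    e (y ⊳ t) ≤ cylSum e y.length t :=
  Finset.single_le_sum (f := fun y => e (y ⊳ t)) (fun y _ => he (y ⊳ t)) (mem_words.2 rfl)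

theorem sum_cylSum_cons_replicate_le [NeZero m] {b : Fin m} (hb : b ≠ 0) (he : ∀ x, 0 ≤ e x)
    (p : ℕ) (t : Ray m) :
    ∑ i ∈ Finset.range (p + 1), cylSum e i ((b :: List.replicate (p - i) 0) ⊳ t) ≤
      cylSum e (p + 1) t := by
  simpa only [cylSum, append_appRay] using
    sum_sum_words_append_le hb (ψ := fun y => e (y ⊳ t)) (fun y => he _) p

theorem sum_words_cylSum_cons_le (he : ∀ x, 0 ≤ e x) (b : Fin m) (p k : ℕ) (t : Ray m) :
    ∑ w ∈ words (Fin m) k, cylSum e p ((b :: w) ⊳ t) ≤ cylSum e (p + 1 + k) t := by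
  rw [cylSum_add e (p + 1)]
  gcongr with w
  exact cylSum_appRay_le he p [b] (w ⊳ t)

end Cylinders

section Scales

variable {d m : ℕ} [NeZero m] {b : Fin m} {a p k n : ℕ} {q r s : ℝ} {f e : Ray m → ℝ}

/-- `r` bounds the effective resistance between two neighbouring copies of the finite mother graph
on the words of length `n`, each one with the uniform distribution: the two copies are given by
the words after which the letter `c` or `c'` is read, or `b` and then `c` or `c'`. -/
def ScaleBound (d : ℕ) (b : Fin m) (n : ℕ) (r : ℝ) : Prop :=
  ∀ ⦃f e⦄, EnergyMajorant (motherGraph d m) f e → ∀ u, u = [] ∨ u = [b] → ∀ c c' t,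
    (cylMean f n ((u ++ [c]) ⊳ t) - cylMean f n ((u ++ [c']) ⊳ t)) ^ 2 ≤
      r * (cylSum e n ((u ++ [c]) ⊳ t) + cylSum e n ((u ++ [c']) ⊳ t))

/-- `s` bounds the effective resistance, in the finite mother graph on the words of length `p`,
between the uniform distribution and the measure defining `sparseMean b a p`. -/
def SpreadBound (d : ℕ) (b : Fin m) (a p : ℕ) (s : ℝ) : Prop :=
  ∀ ⦃f e⦄, EnergyMajorant (motherGraph d m) f e → ∀ t,
    (cylMean f p t - sparseMean b a p fun y => f (y ⊳ t)) ^ 2 ≤ s * cylSum e p t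

theorem ScaleBound.sq_cylMean_succ_sub_le (h : ScaleBound d b n r) (hr : 0 ≤ r)
    (hmaj : EnergyMajorant (motherGraph d m) f e) (t : Ray m) :
    (cylMean f (n + 1) t - cylMean f n ([b] ⊳ t)) ^ 2 ≤ 2 * r * cylSum e (n + 1) t := by
  rw [cylMean_add]
  refine sq_expect_sub_le (nonempty_words _ _) fun z hz => ?_
  obtain ⟨c, rfl⟩ := List.length_eq_one_iff.1 (mem_words.1 hz)
  calc (cylMean f n ([c] ⊳ t) - cylMean f n ([b] ⊳ t)) ^ 2
      ≤ r * (cylSum e n ([c] ⊳ t) + cylSum e n ([b] ⊳ t)) := h hmaj [] (Or.inl rfl) c b t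
    _ ≤ r * (cylSum e (n + 1) t + cylSum e (n + 1) t) := by
        gcongr <;> exact cylSum_appRay_le hmaj.nonneg n [_] t
    _ = 2 * r * cylSum e (n + 1) t := by ring

theorem exists_isActivePrefix_append {u : List (Fin m)} (hu : u = [] ∨ u = [b]) (k : ℕ) :
    ∃ x : List (Fin m), x.length = k ∧ IsActivePrefix 0 b (x ++ u) := by
  obtain rfl | rfl := hu
  · simpa using exists_isActivePrefix_length_eq b k
  · exact ⟨List.replicate k 0, List.length_replicate,
      isActivePrefix_append_singleton (by simp [List.countP_replicate])⟩

theorem SparseMassBound.sq_sub_sparseMean_le (h : SparseMassBound b a p q) (hq : 0 ≤ q)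
    (ha : a + 1 ≤ d) (hb : b ≠ 0) (hmaj : EnergyMajorant (motherGraph d m) f e)
    {z x : List (Fin m)} (hz : z.length = k) (hx : x.length = k) (t : Ray m) :
    (sparseMean b a p (fun y => f ((y ++ b :: z) ⊳ t)) -
        sparseMean b a p fun y => f ((y ++ b :: x) ⊳ t)) ^ 2 ≤
      2 ^ k * q * cylSum e (p + 1 + k) t := by
  rw [← sparseMean_sub]
  have hpath (y : List (Fin m)) (hy : y ∈ sparseWords (Fin m) a p) :
      (f ((y ++ b :: z) ⊳ t) - f ((y ++ b :: x) ⊳ t)) ^ 2 ≤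
        2 ^ k * ∑ w ∈ words (Fin m) k, e ((y ++ b :: w) ⊳ t) := by
    simpa using (hmaj.grayGraph_append hb (isActivePrefix_append_singleton
      (mem_sparseWords.1 hy).2) ha t).sq_sub_le_sum_words hz hx
  calc _ ≤ q * ∑ y ∈ sparseWords (Fin m) a p,
          (f ((y ++ b :: z) ⊳ t) - f ((y ++ b :: x) ⊳ t)) ^ 2 := h _
    _ ≤ q * ∑ y ∈ sparseWords (Fin m) a p,
          2 ^ k * ∑ w ∈ words (Fin m) k, e ((y ++ b :: w) ⊳ t) := by
        gcongr with y hy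
        exact hpath y hy
    _ ≤ q * ∑ y ∈ words (Fin m) p, 2 ^ k * ∑ w ∈ words (Fin m) k, e ((y ++ b :: w) ⊳ t) := by
        gcongr
        · exact fun y _ _ => mul_nonneg (by positivity) (Finset.sum_nonneg fun w _ => hmaj.nonneg _)
        · exact sparseWords_subset_words a p
    _ = 2 ^ k * q * ∑ w ∈ words (Fin m) k, cylSum e p ((b :: w) ⊳ t) := by
        rw [← Finset.mul_sum, Finset.sum_comm]
        simp only [cylSum, append_appRay]
        ring
    _ ≤ 2 ^ k * q * cylSum e (p + 1 + k) t := by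
        gcongr
        exact sum_words_cylSum_cons_le hmaj.nonneg b p k t

theorem sq_cylMean_sub_sparseMean_le (hscale : ScaleBound d b p r) (hr : 0 ≤ r)
    (hspread : SpreadBound d b a p s) (hs : 0 ≤ s) (hmass : SparseMassBound b a p q) (hq : 0 ≤ q)
    (ha : a + 1 ≤ d) (hb : b ≠ 0) (hmaj : EnergyMajorant (motherGraph d m) f e)
    {x : List (Fin m)} (hx : x.length = k) (t : Ray m) :
    (cylMean f (p + 1 + k) t - sparseMean b a p fun y => f ((y ++ b :: x) ⊳ t)) ^ 2 ≤
      3 * ((2 * r + s) / m ^ k + 2 ^ k * q) * cylSum e (p + 1 + k) t := by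
  set E := cylSum e (p + 1 + k) t with hE
  set L := sparseMean b a p fun y => f ((y ++ b :: x) ⊳ t)
  have hterm (z : List (Fin m)) (hz : z ∈ words (Fin m) k) :
      (cylMean f (p + 1) (z ⊳ t) - L) ^ 2 ≤
        3 * ((2 * r + s) * cylSum e (p + 1) (z ⊳ t) + 2 ^ k * q * E) := by
    have hcopy : (cylMean f (p + 1) (z ⊳ t) - cylMean f p ((b :: z) ⊳ t)) ^ 2 ≤
        2 * r * cylSum e (p + 1) (z ⊳ t) := hscale.sq_cylMean_succ_sub_le hr hmaj (z ⊳ t)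
    have hsparse : (cylMean f p ((b :: z) ⊳ t) -
        sparseMean b a p fun y => f ((y ++ b :: z) ⊳ t)) ^ 2 ≤ s * cylSum e (p + 1) (z ⊳ t) := by
      simp only [append_appRay]
      refine (hspread hmaj _).trans ?_
      gcongr
      exact cylSum_appRay_le hmaj.nonneg p [b] (z ⊳ t)
    have hpath := hmass.sq_sub_sparseMean_le hq ha hb hmaj (mem_words.1 hz) hx t
    linarith [sq_sub_le_three_mul (cylMean f (p + 1) (z ⊳ t)) (cylMean f p ((b :: z) ⊳ t))
      (sparseMean b a p fun y => f ((y ++ b :: z) ⊳ t)) L]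
  have hcard : ((words (Fin m) k).card : ℝ) = m ^ k := by simp [card_words]
  have hm : (m : ℝ) ≠ 0 := Nat.cast_ne_zero.2 (NeZero.ne m)
  calc (cylMean f (p + 1 + k) t - L) ^ 2
      = (𝔼 z ∈ words (Fin m) k, (cylMean f (p + 1) (z ⊳ t) - L)) ^ 2 := by
        rw [cylMean_add, Finset.expect_sub_distrib, Finset.expect_const (nonempty_words _ k)]
    _ ≤ (∑ z ∈ words (Fin m) k, (cylMean f (p + 1) (z ⊳ t) - L) ^ 2) / m ^ k :=
        hcard ▸ sq_expect_le_sum_sq_div_card _ _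
    _ ≤ (∑ z ∈ words (Fin m) k,
          3 * ((2 * r + s) * cylSum e (p + 1) (z ⊳ t) + 2 ^ k * q * E)) / m ^ k := by
        gcongr with z hz
        exact hterm z hz
    _ = 3 * ((2 * r + s) / m ^ k + 2 ^ k * q) * E := by
        rw [← Finset.mul_sum, Finset.sum_add_distrib, ← Finset.mul_sum, ← cylSum_add,
          Finset.sum_const, nsmul_eq_mul, hcard, ← hE]
        field_simp

theorem SparseMassBound.sq_sparseMean_sub_le_of_isActivePrefix (h : SparseMassBound b a p q)
    (hq : 0 ≤ q) (ha : a + 1 ≤ d) (hb : b ≠ 0) (hmaj : EnergyMajorant (motherGraph d m) f e)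
    {x u : List (Fin m)} (hx : x.length = k) (hactive : IsActivePrefix 0 b (x ++ u))
    (c c' : Fin m) (t : Ray m) :
    (sparseMean b a p (fun y => f ((y ++ b :: x) ⊳ (u ++ [c]) ⊳ t)) -
        sparseMean b a p fun y => f ((y ++ b :: x) ⊳ (u ++ [c']) ⊳ t)) ^ 2 ≤
      q * cylSum e (p + 1 + k) ((u ++ [c]) ⊳ t) := by
  rw [← sparseMean_sub]
  have hedge (y : List (Fin m)) (hy : y ∈ sparseWords (Fin m) a p) :
      (f ((y ++ b :: x) ⊳ (u ++ [c]) ⊳ t) - f ((y ++ b :: x) ⊳ (u ++ [c']) ⊳ t)) ^ 2 ≤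
        e (y ⊳ (b :: x) ⊳ (u ++ [c]) ⊳ t) := by
    simpa [← append_appRay] using hmaj.sq_sub_le_of_isActivePrefix hb
      (((isActivePrefix_append_singleton (mem_sparseWords.1 hy).2).append hactive).mono ha) c c' t
  have hlength : p + 1 + k = p + (b :: x).length := by simp [hx, add_assoc, add_comm 1]
  calc _ ≤ q * ∑ y ∈ sparseWords (Fin m) a p,
          (f ((y ++ b :: x) ⊳ (u ++ [c]) ⊳ t) - f ((y ++ b :: x) ⊳ (u ++ [c']) ⊳ t)) ^ 2 := h _
    _ ≤ q * ∑ y ∈ sparseWords (Fin m) a p, e (y ⊳ (b :: x) ⊳ (u ++ [c]) ⊳ t) := by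
        gcongr with y hy
        exact hedge y hy
    _ ≤ q * cylSum e p ((b :: x) ⊳ (u ++ [c]) ⊳ t) := by
        gcongr
        exact Finset.sum_le_sum_of_subset_of_nonneg (sparseWords_subset_words a p)
          fun y _ _ => hmaj.nonneg _
    _ ≤ q * cylSum e (p + 1 + k) ((u ++ [c]) ⊳ t) := by
        gcongr
        rw [hlength]
        exact cylSum_appRay_le hmaj.nonneg p (b :: x) _

theorem ScaleBound.of_sparseMean (hscale : ScaleBound d b p r) (hr : 0 ≤ r)
    (hspread : SpreadBound d b a p s) (hs : 0 ≤ s) (hmass : SparseMassBound b a p q) (hq : 0 ≤ q)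
    (ha : a + 1 ≤ d) (hb : b ≠ 0) (k : ℕ) :
    ScaleBound d b (p + 1 + k) (12 * ((2 * r + s) / m ^ k + 2 ^ k * q)) := by
  intro f e hmaj u hu c c' t
  obtain ⟨x, hx, hactive⟩ := exists_isActivePrefix_append hu k
  set D := (2 * r + s) / m ^ k + 2 ^ k * q
  have hqD : q ≤ D := (le_mul_of_one_le_left hq (one_le_pow₀ one_le_two)).trans
    (le_add_of_nonneg_left (by positivity))
  have hmean (c : Fin m) := sq_cylMean_sub_sparseMean_le hscale hr hspread hs hmass hq ha hb hmaj
    hx ((u ++ [c]) ⊳ t)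
  have hbridge := hmass.sq_sparseMean_sub_le_of_isActivePrefix hq ha hb hmaj hx hactive c c' t
  have hmean' := hmean c'
  rw [sub_sq_comm] at hmean'
  have hE := cylSum_nonneg hmaj.nonneg (p + 1 + k) ((u ++ [c]) ⊳ t)
  linarith [hmean c, mul_le_mul_of_nonneg_right hqD hE,
    mul_nonneg (hq.trans hqD) (cylSum_nonneg hmaj.nonneg (p + 1 + k) ((u ++ [c']) ⊳ t)),
    sq_sub_le_three_mul (cylMean f (p + 1 + k) ((u ++ [c]) ⊳ t))
      (sparseMean b a p fun y => f ((y ++ b :: x) ⊳ (u ++ [c]) ⊳ t))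
      (sparseMean b a p fun y => f ((y ++ b :: x) ⊳ (u ++ [c']) ⊳ t))
      (cylMean f (p + 1 + k) ((u ++ [c']) ⊳ t))]

theorem scaleBound_two_pow (hd : 1 ≤ d) (hb : b ≠ 0) (n : ℕ) : ScaleBound d b n (6 * 2 ^ n) := by
  intro f e hmaj u hu c c' t
  obtain ⟨x, hx, hactive⟩ := exists_isActivePrefix_append hu n
  have hpath (c : Fin m) : (cylMean f n ((u ++ [c]) ⊳ t) - f (x ⊳ (u ++ [c]) ⊳ t)) ^ 2 ≤
      2 ^ n * cylSum e n ((u ++ [c]) ⊳ t) := by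
    refine sq_expect_sub_le (nonempty_words _ _) fun y hy => ?_
    simpa [cylSum] using (hmaj.grayGraph_append hb (isActivePrefix_nil (a := 0) (b := b)) hd
      ((u ++ [c]) ⊳ t)).sq_sub_le_sum_words (mem_words.1 hy) hx
  have hedge : (f (x ⊳ (u ++ [c]) ⊳ t) - f (x ⊳ (u ++ [c']) ⊳ t)) ^ 2 ≤
      cylSum e n ((u ++ [c]) ⊳ t) := by
    have h := hmaj.sq_sub_le_of_isActivePrefix hb (hactive.mono (Nat.zero_le d)) c c' t
    rw [← append_appRay, ← append_appRay, ← List.append_assoc, ← List.append_assoc]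
    refine h.trans ?_
    rw [List.append_assoc, append_appRay, ← hx]
    exact apply_appRay_le_cylSum hmaj.nonneg x _
  have hpath' := hpath c'
  rw [sub_sq_comm] at hpath'
  have hE (c : Fin m) := cylSum_nonneg hmaj.nonneg n ((u ++ [c]) ⊳ t)
  linarith [hpath c, mul_nonneg (pow_nonneg zero_le_two n) (hE c'),
    le_mul_of_one_le_left (hE c) (one_le_pow₀ one_le_two (n := n) (M₀ := ℝ)),
    sq_sub_le_three_mul (cylMean f n ((u ++ [c]) ⊳ t))
    (f (x ⊳ (u ++ [c]) ⊳ t)) (f (x ⊳ (u ++ [c']) ⊳ t)) (cylMean f n ((u ++ [c']) ⊳ t))]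

end Scales

/-! ### Climbing from small to large cylinders -/

theorem sq_sub_le_sum_Ico_mul_sum_Ico {x r g : ℕ → ℝ} {i p : ℕ} (hip : i ≤ p)
    (hr : ∀ j, 0 ≤ r j) (hg : ∀ j, 0 ≤ g j)
    (h : ∀ j ∈ Finset.Ico i p, (x (j + 1) - x j) ^ 2 ≤ r j * g j) :
    (x p - x i) ^ 2 ≤ (∑ j ∈ Finset.Ico i p, r j) * ∑ j ∈ Finset.Ico i p, g j := by
  rw [← Finset.sum_Ico_sub x hip]
  exact Finset.sum_sq_le_sum_mul_sum_of_sq_le_mul _ (fun j _ => hr j) (fun j _ => hg j) h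

section Ladder

variable {d m : ℕ} [NeZero m] {b : Fin m} {a i p : ℕ} {s : ℝ} {r : ℕ → ℝ} {f e : Ray m → ℝ}

theorem ScaleBound.sq_cylMean_succ_sub_cylMean_le {r : ℝ} (h : ScaleBound d b p r) (hr : 0 ≤ r)
    (hmaj : EnergyMajorant (motherGraph d m) f e) (t : Ray m) :
    (cylMean f (p + 1) ([b] ⊳ t) - cylMean f p ([b, 0] ⊳ t)) ^ 2 ≤
      r * (6 * (cylSum e (p + 1) ([b] ⊳ t) + cylSum e p ([b, 0] ⊳ t))) := by
  have hcopy : (cylMean f (p + 1) ([b] ⊳ t) - cylMean f p ([b, b] ⊳ t)) ^ 2 ≤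
      2 * r * cylSum e (p + 1) ([b] ⊳ t) := h.sq_cylMean_succ_sub_le hr hmaj ([b] ⊳ t)
  have hnext : (cylMean f p ([b, b] ⊳ t) - cylMean f p ([b, 0] ⊳ t)) ^ 2 ≤
      r * (cylSum e p ([b, b] ⊳ t) + cylSum e p ([b, 0] ⊳ t)) := h hmaj [b] (Or.inr rfl) b 0 t
  have hsum : cylSum e p ([b, b] ⊳ t) ≤ cylSum e (p + 1) ([b] ⊳ t) :=
    cylSum_appRay_le hmaj.nonneg p [b] ([b] ⊳ t)
  have hadd := add_sq_le (a := cylMean f (p + 1) ([b] ⊳ t) - cylMean f p ([b, b] ⊳ t))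
    (b := cylMean f p ([b, b] ⊳ t) - cylMean f p ([b, 0] ⊳ t))
  rw [sub_add_sub_cancel] at hadd
  linarith [mul_le_mul_of_nonneg_left hsum hr,
    mul_nonneg hr (cylSum_nonneg hmaj.nonneg p ([b, 0] ⊳ t))]

theorem sq_cylMean_sub_cylMean_le_sum_Ico (hb : b ≠ 0) (hip : i ≤ p) (hr : ∀ j, 0 ≤ r j)
    (h : ∀ j < p, ScaleBound d b j (r j)) (hmaj : EnergyMajorant (motherGraph d m) f e)
    (t : Ray m) :
    (cylMean f p ([b] ⊳ t) - cylMean f i ((b :: List.replicate (p - i) 0) ⊳ t)) ^ 2 ≤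
      12 * (∑ j ∈ Finset.Ico i p, r j) * cylSum e (p + 1) t := by
  let E (j : ℕ) := cylSum e j ((b :: List.replicate (p - j) 0) ⊳ t)
  have hE (j : ℕ) : 0 ≤ E j := cylSum_nonneg hmaj.nonneg _ _
  have hrung (j : ℕ) (hj : j ∈ Finset.Ico i p) :
      (cylMean f (j + 1) ((b :: List.replicate (p - (j + 1)) 0) ⊳ t) -
          cylMean f j ((b :: List.replicate (p - j) 0) ⊳ t)) ^ 2 ≤
        r j * (6 * (E (j + 1) + E j)) := by
    have hjp : j < p := (Finset.mem_Ico.1 hj).2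
    simpa [E, show p - j = p - (j + 1) + 1 by lia, List.replicate_succ, ← append_appRay] using
      (h j hjp).sq_cylMean_succ_sub_cylMean_le (hr j) hmaj (List.replicate (p - (j + 1)) 0 ⊳ t)
  have hsum : ∑ j ∈ Finset.range (p + 1), E j ≤ cylSum e (p + 1) t :=
    sum_cylSum_cons_replicate_le hb hmaj.nonneg p t
  have hlower : ∑ j ∈ Finset.Ico i p, E j ≤ ∑ j ∈ Finset.range (p + 1), E j :=
    Finset.sum_le_sum_of_subset_of_nonneg
      (fun j hj => by simp only [Finset.mem_Ico, Finset.mem_range] at *; lia) fun j _ _ => hE j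
  have hupper : ∑ j ∈ Finset.Ico i p, E (j + 1) ≤ ∑ j ∈ Finset.range (p + 1), E j := by
    rw [Finset.sum_Ico_add' E i p 1]
    exact Finset.sum_le_sum_of_subset_of_nonneg
      (fun j hj => by simp only [Finset.mem_Ico, Finset.mem_range] at *; lia) fun j _ _ => hE j
  calc _ ≤ (∑ j ∈ Finset.Ico i p, r j) * ∑ j ∈ Finset.Ico i p, 6 * (E (j + 1) + E j) := by
        simpa using sq_sub_le_sum_Ico_mul_sum_Ico
          (x := fun j => cylMean f j ((b :: List.replicate (p - j) 0) ⊳ t))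
          (g := fun j => 6 * (E (j + 1) + E j)) hip hr
          (fun j => mul_nonneg (by norm_num) (add_nonneg (hE (j + 1)) (hE j))) hrung
    _ ≤ (∑ j ∈ Finset.Ico i p, r j) * (12 * cylSum e (p + 1) t) := by
        rw [← Finset.mul_sum, Finset.sum_add_distrib]
        refine mul_le_mul_of_nonneg_left ?_ (Finset.sum_nonneg fun j _ => hr j)
        linarith
    _ = 12 * (∑ j ∈ Finset.Ico i p, r j) * cylSum e (p + 1) t := by ring

theorem sq_cylMean_succ_sub_cylMean_le_sum_Ico (hb : b ≠ 0) (hip : i ≤ p) (hr : ∀ j, 0 ≤ r j)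
    (h : ∀ j ≤ p, ScaleBound d b j (r j)) (hmaj : EnergyMajorant (motherGraph d m) f e)
    (t : Ray m) :
    (cylMean f (p + 1) t - cylMean f i ((b :: List.replicate (p - i) 0) ⊳ t)) ^ 2 ≤
      24 * (∑ j ∈ Finset.Ico i (p + 1), r j) * cylSum e (p + 1) t := by
  have hcopy := (h p le_rfl).sq_cylMean_succ_sub_le (hr p) hmaj t
  have hclimb := sq_cylMean_sub_cylMean_le_sum_Ico hb hip hr (fun j hj => h j hj.le) hmaj t
  have hadd := add_sq_le (a := cylMean f (p + 1) t - cylMean f p ([b] ⊳ t))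
    (b := cylMean f p ([b] ⊳ t) - cylMean f i ((b :: List.replicate (p - i) 0) ⊳ t))
  rw [sub_add_sub_cancel] at hadd
  rw [Finset.sum_Ico_succ_top hip]
  linarith [mul_nonneg (hr p) (cylSum_nonneg hmaj.nonneg (p + 1) t)]

theorem spreadBound_zero_right (d : ℕ) (b : Fin m) (a : ℕ) (hs : 0 ≤ s) :
    SpreadBound d b a 0 s := fun f e hmaj t => by
  have hf : cylMean f 0 t = f t := by simp [cylMean]
  have hL : sparseMean b a 0 (fun y => f (y ⊳ t)) = f t := by cases a <;> rfl
  rw [hf, hL, sub_self, zero_pow two_ne_zero]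
  exact mul_nonneg hs (cylSum_nonneg hmaj.nonneg 0 t)

theorem spreadBound_zero_left_succ (hb : b ≠ 0) (hr : ∀ j, 0 ≤ r j)
    (h : ∀ j ≤ p, ScaleBound d b j (r j)) :
    SpreadBound d b 0 (p + 1) (48 * ∑ j ∈ Finset.range (p + 1), r j + 2) := fun f e hmaj t => by
  let t' := List.replicate p 0 ⊳ t
  have hclimb : (cylMean f (p + 1) t - f ([b] ⊳ t')) ^ 2 ≤
      24 * (∑ j ∈ Finset.range (p + 1), r j) * cylSum e (p + 1) t := by
    simpa [cylMean, ← append_appRay, t'] using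
      sq_cylMean_succ_sub_cylMean_le_sum_Ico hb p.zero_le hr h hmaj t
  have hedge : (f ([b] ⊳ t') - f ([0] ⊳ t')) ^ 2 ≤ cylSum e (p + 1) t := by
    refine (hmaj.sq_sub_le_of_isActivePrefix hb isActivePrefix_nil b 0 t').trans ?_
    simpa [← append_appRay, t'] using
      apply_appRay_le_cylSum hmaj.nonneg (b :: List.replicate p 0) t
  have hadd := add_sq_le (a := cylMean f (p + 1) t - f ([b] ⊳ t'))
    (b := f ([b] ⊳ t') - f ([0] ⊳ t'))
  rw [sub_add_sub_cancel] at hadd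
  change (cylMean f (p + 1) t - f ([0] ⊳ t')) ^ 2 ≤ _
  linarith

theorem SpreadBound.succ (hb : b ≠ 0) (hs : 0 ≤ s)
    (hspread : ∀ i ∈ upperHalf p, SpreadBound d b a i s) (hr : ∀ j, 0 ≤ r j)
    (h : ∀ j ≤ p, ScaleBound d b j (r j)) :
    SpreadBound d b (a + 1) (p + 1)
      (48 * ∑ j ∈ upperHalf p, r j + 2 * (s / (upperHalf p).card)) := fun f e hmaj t => by
  let x (i : ℕ) := (b :: List.replicate (p - i) 0) ⊳ t
  let L (i : ℕ) := sparseMean b a i fun y => f (y ⊳ x i)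
  have hE := cylSum_nonneg hmaj.nonneg (p + 1) t
  have hclimb (i : ℕ) (hi : i ∈ upperHalf p) : (cylMean f i (x i) - cylMean f (p + 1) t) ^ 2 ≤
      24 * (∑ j ∈ upperHalf p, r j) * cylSum e (p + 1) t := by
    obtain ⟨hi, hip⟩ := Finset.mem_Ico.1 hi
    rw [sub_sq_comm]
    refine (sq_cylMean_succ_sub_cylMean_le_sum_Ico hb (Nat.le_of_lt_succ hip) hr h hmaj t).trans ?_
    gcongr
    exacts [fun j _ _ => hr j, Finset.Ico_subset_Ico_left hi]
  have hlevel : (𝔼 i ∈ upperHalf p, (cylMean f i (x i) - L i)) ^ 2 ≤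
      s / (upperHalf p).card * cylSum e (p + 1) t := by
    calc _ ≤ (∑ i ∈ upperHalf p, (cylMean f i (x i) - L i) ^ 2) / (upperHalf p).card :=
          sq_expect_le_sum_sq_div_card _ _
      _ ≤ (∑ i ∈ upperHalf p, s * cylSum e i (x i)) / (upperHalf p).card := by
          gcongr with i hi
          exact hspread i hi hmaj (x i)
      _ ≤ s * (∑ i ∈ Finset.range (p + 1), cylSum e i (x i)) / (upperHalf p).card := by
          rw [← Finset.mul_sum]
          gcongr
          exacts [fun i _ _ => cylSum_nonneg hmaj.nonneg _ _, upperHalf_subset_range p]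
      _ ≤ s * cylSum e (p + 1) t / (upperHalf p).card := by
          gcongr
          exact sum_cylSum_cons_replicate_le hb hmaj.nonneg p t
      _ = s / (upperHalf p).card * cylSum e (p + 1) t := by ring
  have hmean := sq_expect_sub_le (nonempty_upperHalf p) hclimb
  rw [sub_sq_comm] at hmean
  have hadd := add_sq_le (a := cylMean f (p + 1) t - 𝔼 i ∈ upperHalf p, cylMean f i (x i))
    (b := 𝔼 i ∈ upperHalf p, (cylMean f i (x i) - L i))
  rw [Finset.expect_sub_distrib, sub_add_sub_cancel] at hadd
  rw [Finset.expect_sub_distrib] at hlevel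
  simp only [sparseMean, append_appRay]
  linarith

end Ladder

/-! ### Polynomial decay of the resistances -/

theorem rpow_neg_le_two_rpow_mul {x y r : ℝ} (hx : 0 < x) (h : x ≤ 2 * y) (hr : 0 ≤ r) :
    y ^ (-r) ≤ 2 ^ r * x ^ (-r) := by
  have hy : y = 2⁻¹ * (2 * y) := by ring
  rw [hy, Real.mul_rpow (by norm_num) (hx.le.trans h), Real.inv_rpow zero_le_two,
    Real.rpow_neg zero_le_two, inv_inv]
  gcongr ?_ * ?_
  exact Real.rpow_le_rpow_of_nonpos hx h (neg_nonpos.2 hr)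

theorem div_pow_le_two_pow_mul_div_pow {x y c : ℝ} (hx : 0 < x) (h : x ≤ 2 * y) (hc : 0 ≤ c)
    (l : ℕ) : c / y ^ l ≤ 2 ^ l * c / x ^ l := by
  have hy : 0 < y := by linarith
  rw [div_le_div_iff₀ (by positivity) (by positivity), mul_comm _ c, mul_assoc, ← mul_pow]
  gcongr

theorem eventually_exists_pow_mem_Icc {y M : ℝ} (hy : 2 ≤ y) (hM : 1 ≤ M) :
    ∀ᶠ n : ℕ in Filter.atTop, ∃ k, 2 * k + 1 ≤ n ∧
      y ^ k ∈ Set.Icc (M * (n + 1)) (y * (M * (n + 1))) := by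
  have hlim := (tendsto_pow_const_div_const_pow_of_one_lt (r := 2) 2 one_lt_two).comp
    (Filter.tendsto_add_atTop_nat 1)
  filter_upwards [hlim.eventually_lt_const (show 0 < (8 * M ^ 2)⁻¹ by positivity)] with n hn
  have hsq : (2 * (M * (n + 1))) ^ 2 < 2 ^ n := by
    simp only [Function.comp_apply, Nat.cast_add, Nat.cast_one] at hn
    rw [div_lt_iff₀ (by positivity), lt_inv_mul_iff₀ (by positivity), pow_succ 2 n] at hn
    linarith
  obtain ⟨j, hj, hj'⟩ := exists_nat_pow_near (x := M * (n + 1)) (y := y)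
    (one_le_mul_of_one_le_of_one_le hM (le_add_of_nonneg_left n.cast_nonneg)) (by linarith)
  refine ⟨j + 1, ?_, hj'.le, by rw [pow_succ']; gcongr⟩
  by_contra! hjn
  refine hsq.not_ge ?_
  calc (2 : ℝ) ^ n ≤ 2 ^ (2 * (j + 1)) := pow_le_pow_right₀ one_le_two (by lia)
    _ = (2 * 2 ^ j) ^ 2 := by ring
    _ ≤ (2 * (M * (n + 1))) ^ 2 := by
        gcongr
        exact (pow_le_pow_left₀ zero_le_two hy j).trans hj

theorem two_pow_div_pow_le_rpow {x y z β θ : ℝ} {k l : ℕ} (hx : 1 ≤ x) (hy : 0 ≤ y) (hz : 0 ≤ z)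
    (hk : y ^ k ≤ z * x) (hβ : 0 ≤ β) (hyβ : 2 ≤ y ^ β) (hl : θ + β ≤ l) :
    2 ^ k / x ^ l ≤ z ^ β * x ^ (-θ) := by
  have hx0 : 0 < x := zero_lt_one.trans_le hx
  calc 2 ^ k / x ^ l ≤ (y ^ β) ^ k / x ^ l := by gcongr
    _ = (y ^ k) ^ β / x ^ l := by rw [Real.rpow_pow_comm hy]
    _ ≤ (z * x) ^ β / x ^ l := by gcongr
    _ = z ^ β * x ^ (β - l) := by
        rw [Real.mul_rpow hz hx0.le, Real.rpow_sub hx0, Real.rpow_natCast, mul_div_assoc]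
    _ ≤ z ^ β * x ^ (-θ) := by
        gcongr
        linarith

theorem add_two_le_two_mul_of_mem_upperHalf {p i : ℕ} (hi : i ∈ upperHalf p) :
    (p : ℝ) + 2 ≤ 2 * (i + 1) := by
  have : p + 2 ≤ 2 * (i + 1) := by
    have := (Finset.mem_Ico.1 hi).1
    lia
  exact_mod_cast this

theorem add_two_le_three_mul_card_upperHalf (p : ℕ) : (p : ℝ) + 2 ≤ 3 * (upperHalf p).card := by
  have : p + 2 ≤ 3 * (upperHalf p).card := by
    rw [upperHalf, Nat.card_Ico]
    lia
  exact_mod_cast this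

theorem div_card_upperHalf_le (p : ℕ) {c : ℝ} (hc : 0 ≤ c) :
    c / (upperHalf p).card ≤ 3 * c / (p + 2) := by
  have hcard : (0 : ℝ) < (upperHalf p).card := mod_cast (nonempty_upperHalf p).card_pos
  rw [div_le_div_iff₀ hcard (by positivity)]
  linarith [mul_le_mul_of_nonneg_left (add_two_le_three_mul_card_upperHalf p) hc]

theorem sum_upperHalf_rpow_neg_le (p : ℕ) {θ : ℝ} (hθ : 0 ≤ θ) :
    ∑ j ∈ upperHalf p, ((j : ℝ) + 1) ^ (-θ) ≤ 2 ^ θ * ((p : ℝ) + 2) ^ (1 - θ) := by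
  have hp : (0 : ℝ) < p + 2 := by positivity
  have hcard : ((upperHalf p).card : ℝ) ≤ p + 2 := by
    have : (upperHalf p).card ≤ p + 1 := by
      simpa using Finset.card_le_card (upperHalf_subset_range p)
    linarith [(Nat.cast_le (α := ℝ)).2 this, Nat.cast_succ (R := ℝ) p]
  calc ∑ j ∈ upperHalf p, ((j : ℝ) + 1) ^ (-θ)
      ≤ ∑ j ∈ upperHalf p, 2 ^ θ * ((p : ℝ) + 2) ^ (-θ) := Finset.sum_le_sum fun j hj =>
        rpow_neg_le_two_rpow_mul hp (add_two_le_two_mul_of_mem_upperHalf hj) hθ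
    _ = (upperHalf p).card * (2 ^ θ * ((p : ℝ) + 2) ^ (-θ)) := by
        rw [Finset.sum_const, nsmul_eq_mul]
    _ ≤ (p + 2) * (2 ^ θ * ((p : ℝ) + 2) ^ (-θ)) := by gcongr
    _ = 2 ^ θ * ((p : ℝ) + 2) ^ (1 - θ) := by
        rw [sub_eq_add_neg, Real.rpow_add hp, Real.rpow_one]
        ring

theorem exists_forall_sum_rpow_neg_le {θ : ℝ} (hθ : 1 < θ) :
    ∃ W : ℝ, 0 ≤ W ∧ ∀ n, ∑ j ∈ Finset.range n, ((j : ℝ) + 1) ^ (-θ) ≤ W := by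
  have hsum : Summable fun j : ℕ => ((j : ℝ) + 1) ^ (-θ) := by
    simpa using (summable_nat_add_iff 1).2 (Real.summable_nat_rpow.2 (neg_lt_neg hθ))
  have hpos (j : ℕ) : 0 ≤ ((j : ℝ) + 1) ^ (-θ) := by positivity
  exact ⟨_, tsum_nonneg hpos, fun n => hsum.sum_le_tsum _ fun j _ => hpos j⟩

theorem SparseMassBound.mono {α : Type*} [Zero α] [Finite α] [DecidableEq α] {b : α} {a p : ℕ}
    {q q' : ℝ} (h : SparseMassBound b a p q) (hq : q ≤ q') : SparseMassBound b a p q' := fun φ =>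
  (h φ).trans (mul_le_mul_of_nonneg_right hq (Finset.sum_nonneg fun _ _ => sq_nonneg _))

theorem exists_forall_sparseMassBound {α : Type*} [Zero α] [Finite α] [DecidableEq α] {b : α}
    (hb : b ≠ 0) (a : ℕ) :
    ∃ Q : ℝ, 1 ≤ Q ∧ ∀ p : ℕ, SparseMassBound b a p (Q / ((p : ℝ) + 1) ^ a) := by
  induction a with
  | zero => exact ⟨1, le_rfl, fun p => by simpa using sparseMassBound_zero_left b p⟩
  | succ a ih =>
    obtain ⟨Q, hQ, h⟩ := ih
    have hQ' : 1 ≤ 3 * (2 ^ a * Q) := by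
      linarith [one_le_mul_of_one_le_of_one_le (one_le_pow₀ (n := a) one_le_two) hQ]
    refine ⟨3 * (2 ^ a * Q), hQ', fun p => ?_⟩
    cases p with
    | zero => simpa using (sparseMassBound_zero_right b (a + 1)).mono hQ'
    | succ p =>
      have hmass (i : ℕ) (hi : i ∈ upperHalf p) :
          SparseMassBound b a i (2 ^ a * Q / ((p : ℝ) + 2) ^ a) :=
        (h i).mono (div_pow_le_two_pow_mul_div_pow (by positivity)
          (add_two_le_two_mul_of_mem_upperHalf hi) (by linarith) a)
      refine (SparseMassBound.succ hb (by positivity) hmass).mono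
        ((div_card_upperHalf_le p (by positivity)).trans (le_of_eq ?_))
      push_cast
      rw [add_assoc (p : ℝ), one_add_one_eq_two, pow_succ, ← div_div, ← mul_div_assoc]

section Decay

variable {d m : ℕ} [NeZero m] {b : Fin m} {a k n p : ℕ} {r r' s s' S Q M B θ β : ℝ}

theorem ScaleBound.mono (h : ScaleBound d b n r) (hr : r ≤ r') : ScaleBound d b n r' :=
  fun _ _ hmaj u hu c c' t => (h hmaj u hu c c' t).trans <| mul_le_mul_of_nonneg_right hr <|
    add_nonneg (cylSum_nonneg hmaj.nonneg _ _) (cylSum_nonneg hmaj.nonneg _ _)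

theorem SpreadBound.mono (h : SpreadBound d b a p s) (hs : s ≤ s') : SpreadBound d b a p s' :=
  fun _ _ hmaj t =>
    (h hmaj t).trans (mul_le_mul_of_nonneg_right hs (cylSum_nonneg hmaj.nonneg _ _))

theorem SpreadBound.succ_of_rpow (hb : b ≠ 0) (hθ : 0 ≤ θ) (hθ' : θ ≤ 2) (hS : 0 ≤ S) (hB : 0 ≤ B)
    (hspread : ∀ i < p, SpreadBound d b a i (S * B))
    (h : ∀ j < p, ScaleBound d b j (B * ((j : ℝ) + 1) ^ (-θ))) :
    SpreadBound d b (a + 1) p ((48 * 2 ^ θ + 6 * S) * B * ((p : ℝ) + 1) ^ (1 - θ)) := by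
  cases p with
  | zero => exact spreadBound_zero_right d b _ (by positivity)
  | succ p =>
    refine (SpreadBound.succ hb (mul_nonneg hS hB)
      (fun i hi => hspread i (Finset.mem_Ico.1 hi).2) (fun j => by positivity)
      fun j hj => h j (Nat.lt_succ_of_le hj)).mono ?_
    have hinv : ((p : ℝ) + 2)⁻¹ ≤ ((p : ℝ) + 2) ^ (1 - θ) := by
      rw [← Real.rpow_neg_one]
      gcongr
      · linarith [p.cast_nonneg (α := ℝ)]
      · linarith
    calc 48 * ∑ j ∈ upperHalf p, B * ((j : ℝ) + 1) ^ (-θ) + 2 * (S * B / (upperHalf p).card)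
        ≤ 48 * (B * (2 ^ θ * ((p : ℝ) + 2) ^ (1 - θ))) + 2 * (3 * (S * B) / (p + 2)) := by
          rw [← Finset.mul_sum]
          gcongr 48 * (B * ?_) + 2 * ?_
          · exact sum_upperHalf_rpow_neg_le p hθ
          · exact div_card_upperHalf_le p (mul_nonneg hS hB)
      _ ≤ 48 * (B * (2 ^ θ * ((p : ℝ) + 2) ^ (1 - θ))) +
          2 * (3 * (S * B) * ((p : ℝ) + 2) ^ (1 - θ)) := by
          rw [div_eq_mul_inv]
          gcongr
      _ = (48 * 2 ^ θ + 6 * S) * B * (((p + 1 : ℕ) : ℝ) + 1) ^ (1 - θ) := by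
          push_cast
          rw [add_assoc (p : ℝ), one_add_one_eq_two]
          ring

theorem exists_forall_spreadBound (d : ℕ) (hb : b ≠ 0) (hθ : 1 < θ) (hθ' : θ ≤ 2) (a : ℕ) :
    ∃ S : ℝ, 0 ≤ S ∧ ∀ B : ℝ, 1 ≤ B → ∀ p : ℕ,
      (∀ j < p, ScaleBound d b j (B * ((j : ℝ) + 1) ^ (-θ))) → SpreadBound d b a p (S * B) := by
  induction a with
  | zero =>
    obtain ⟨W, hW, hsum⟩ := exists_forall_sum_rpow_neg_le hθ
    refine ⟨48 * W + 2, by positivity, fun B hB p h => ?_⟩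
    cases p with
    | zero => exact spreadBound_zero_right d b _ (by positivity)
    | succ p =>
      refine (spreadBound_zero_left_succ hb (fun j => by positivity)
        fun j hj => h j (Nat.lt_succ_of_le hj)).mono ?_
      rw [← Finset.mul_sum]
      linarith [mul_le_mul_of_nonneg_left (hsum (p + 1)) (zero_le_one.trans hB)]
  | succ a ih =>
    obtain ⟨S, hS, ih⟩ := ih
    refine ⟨48 * 2 ^ θ + 6 * S, by positivity, fun B hB p h => ?_⟩
    refine (SpreadBound.succ_of_rpow hb (by linarith) hθ' hS (zero_le_one.trans hB)
      (fun i hi => ih B hB i fun j hj => h j (hj.trans hi)) h).mono ?_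
    exact mul_le_of_le_one_right (by positivity)
      (Real.rpow_le_one_of_one_le_of_nonpos (by simp) (by linarith))

theorem exists_forall_spreadBound_succ (d : ℕ) (hb : b ≠ 0) (hθ : 1 < θ) (hθ' : θ ≤ 2) (a : ℕ) :
    ∃ S : ℝ, 0 ≤ S ∧ ∀ B : ℝ, 1 ≤ B → ∀ p : ℕ,
      (∀ j < p, ScaleBound d b j (B * ((j : ℝ) + 1) ^ (-θ))) →
        SpreadBound d b (a + 1) p (S * B * ((p : ℝ) + 1) ^ (1 - θ)) := by
  obtain ⟨S, hS, h⟩ := exists_forall_spreadBound d hb hθ hθ' a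
  refine ⟨48 * 2 ^ θ + 6 * S, by positivity, fun B hB p hscale => ?_⟩
  exact SpreadBound.succ_of_rpow hb (by linarith) hθ' hS (zero_le_one.trans hB)
    (fun i hi => h B hB i fun j hj => hscale j (hj.trans hi)) hscale

theorem ScaleBound.of_rpow (hb : b ≠ 0) (ha : a + 2 ≤ d) (hθ : 1 ≤ θ) (hS : 0 ≤ S) (hQ : 0 ≤ Q)
    (hB : 0 ≤ B) (hM : 0 < M) (hβ : 0 ≤ β) (hmβ : 2 ≤ (m : ℝ) ^ β) (hθβ : θ + β ≤ (a + 1 : ℕ))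
    (hscale : ScaleBound d b p (B * ((p : ℝ) + 1) ^ (-θ)))
    (hspread : SpreadBound d b (a + 1) p (S * B * ((p : ℝ) + 1) ^ (1 - θ)))
    (hmass : SparseMassBound b (a + 1) p (Q / ((p : ℝ) + 1) ^ (a + 1)))
    (hn : n = p + 1 + k) (hk : 2 * k + 1 ≤ n)
    (hmk : (m : ℝ) ^ k ∈ Set.Icc (M * (n + 1)) (m * (M * (n + 1)))) :
    ScaleBound d b n (12 * (2 ^ (θ - 1) * (2 + S) / M * B +
      2 ^ (a + 1) * Q * (m * M) ^ β) * ((n : ℝ) + 1) ^ (-θ)) := by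
  have hn0 : (0 : ℝ) < n + 1 := by positivity
  have hpn : (n : ℝ) + 1 ≤ 2 * (p + 1) := by
    have : n + 1 ≤ 2 * (p + 1) := by lia
    exact_mod_cast this
  have hpθ : ((p : ℝ) + 1) ^ (1 - θ) ≤ 2 ^ (θ - 1) * ((n : ℝ) + 1) ^ (1 - θ) := by
    simpa using rpow_neg_le_two_rpow_mul hn0 hpn (sub_nonneg.2 hθ)
  have hmean : (2 * (B * ((p : ℝ) + 1) ^ (-θ)) + S * B * ((p : ℝ) + 1) ^ (1 - θ)) / m ^ k ≤
      2 ^ (θ - 1) * (2 + S) / M * B * ((n : ℝ) + 1) ^ (-θ) := by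
    calc _ ≤ (2 * (B * ((p : ℝ) + 1) ^ (1 - θ)) + S * B * ((p : ℝ) + 1) ^ (1 - θ)) /
            (M * (n + 1)) := by
          gcongr
          · simp
          · linarith
          · exact hmk.1
      _ = (2 + S) * B * ((p : ℝ) + 1) ^ (1 - θ) / (M * (n + 1)) := by ring
      _ ≤ (2 + S) * B * (2 ^ (θ - 1) * ((n : ℝ) + 1) ^ (1 - θ)) / (M * (n + 1)) := by gcongr
      _ = 2 ^ (θ - 1) * (2 + S) / M * B * ((n : ℝ) + 1) ^ (-θ) := by
          rw [sub_eq_add_neg 1 θ, Real.rpow_add hn0, Real.rpow_one]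
          field_simp
  have hpaths : 2 ^ k * (Q / ((p : ℝ) + 1) ^ (a + 1)) ≤
      2 ^ (a + 1) * Q * (m * M) ^ β * ((n : ℝ) + 1) ^ (-θ) := by
    calc 2 ^ k * (Q / ((p : ℝ) + 1) ^ (a + 1))
        ≤ 2 ^ k * (2 ^ (a + 1) * Q / ((n : ℝ) + 1) ^ (a + 1)) := by
          gcongr 2 ^ k * ?_
          exact div_pow_le_two_pow_mul_div_pow hn0 hpn hQ (a + 1)
      _ = 2 ^ (a + 1) * Q * (2 ^ k / ((n : ℝ) + 1) ^ (a + 1)) := by ring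
      _ ≤ 2 ^ (a + 1) * Q * ((m * M) ^ β * ((n : ℝ) + 1) ^ (-θ)) := by
          gcongr
          exact two_pow_div_pow_le_rpow (by simp) m.cast_nonneg (by positivity)
            (hmk.2.trans_eq (mul_assoc _ _ _).symm) hβ hmβ hθβ
      _ = 2 ^ (a + 1) * Q * (m * M) ^ β * ((n : ℝ) + 1) ^ (-θ) := by ring
  rw [hn]
  refine (hscale.of_sparseMean (by positivity) hspread (by positivity) hmass (by positivity)
    ha hb k).mono ?_
  rw [← hn]
  linarith

theorem exists_eventually_scaleBound (hm : 2 ≤ m) (hb : b ≠ 0) (ha : a + 2 ≤ d) (hθ : 1 < θ)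
    (hθ' : θ ≤ 2) (hβ : 0 ≤ β) (hmβ : 2 ≤ (m : ℝ) ^ β) (hθβ : θ + β ≤ (a + 1 : ℕ)) :
    ∃ B₀ : ℝ, 1 ≤ B₀ ∧ ∀ᶠ n : ℕ in Filter.atTop, ∀ B, B₀ ≤ B →
      (∀ j < n, ScaleBound d b j (B * ((j : ℝ) + 1) ^ (-θ))) →
        ScaleBound d b n (B * ((n : ℝ) + 1) ^ (-θ)) := by
  obtain ⟨Q, hQ, hmass⟩ := exists_forall_sparseMassBound hb (a + 1)
  obtain ⟨S, hS, hspread⟩ := exists_forall_spreadBound_succ d hb hθ hθ' a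
  have hpow : (1 : ℝ) ≤ 2 ^ (θ - 1) := Real.one_le_rpow one_le_two (by linarith)
  set M := 24 * (2 ^ (θ - 1) * (2 + S)) with hMdef
  have hM : 1 ≤ M := by linarith [one_le_mul_of_one_le_of_one_le hpow (by linarith : 1 ≤ 2 + S)]
  set C := 2 ^ (a + 1) * Q * (m * M) ^ β
  have hC : 0 ≤ C := by positivity
  refine ⟨24 * C + 1, by linarith, ?_⟩
  filter_upwards [eventually_exists_pow_mem_Icc (y := m) (mod_cast hm) hM] with n hn B hB h
  obtain ⟨k, hk, hmk⟩ := hn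
  obtain ⟨p, rfl⟩ : ∃ p, n = p + 1 + k := ⟨n - 1 - k, by lia⟩
  refine (ScaleBound.of_rpow hb ha hθ.le hS (by linarith) (by linarith) (by linarith) hβ hmβ hθβ
    (h p (by lia)) (hspread B (by linarith) p fun j hj => h j (by lia)) (hmass p) rfl hk
    hmk).mono ?_
  gcongr
  have hhalf : 2 ^ (θ - 1) * (2 + S) / M = 1 / 24 := by
    rw [hMdef]
    field_simp
  rw [hhalf]
  linarith

theorem exists_forall_scaleBound (hm : 2 ≤ m) (hb : b ≠ 0) (ha : a + 2 ≤ d) (hθ : 1 < θ)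
    (hθ' : θ ≤ 2) (hβ : 0 ≤ β) (hmβ : 2 ≤ (m : ℝ) ^ β) (hθβ : θ + β ≤ (a + 1 : ℕ)) :
    ∃ B : ℝ, 0 ≤ B ∧ ∀ n : ℕ, ScaleBound d b n (B * ((n : ℝ) + 1) ^ (-θ)) := by
  obtain ⟨B₀, hB₀, hstep⟩ := exists_eventually_scaleBound hm hb ha hθ hθ' hβ hmβ hθβ
  obtain ⟨n₀, hn₀⟩ := Filter.eventually_atTop.1 hstep
  have : 0 ≤ θ := by linarith
  set B := max B₀ (6 * 2 ^ n₀ * ((n₀ : ℝ) + 1) ^ θ)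
  refine ⟨B, zero_le_one.trans (hB₀.trans (le_max_left _ _)), fun n => ?_⟩
  induction n using Nat.strong_induction_on with
  | _ n ih =>
    obtain hn | hn := lt_or_ge n n₀
    · refine (scaleBound_two_pow (by lia) hb n).mono ?_
      rw [Real.rpow_neg (by positivity), ← div_eq_mul_inv, le_div_iff₀ (by positivity)]
      refine le_trans ?_ (le_max_right _ _)
      gcongr
      exact one_le_two
    · exact hn₀ n hn B (le_max_left _ _) ih

theorem exists_forall_scaleBound_of_degree (h : (4 ≤ d ∧ 2 ≤ m) ∨ (3 ≤ d ∧ 3 ≤ m)) (hb : b ≠ 0) :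
    ∃ B : ℝ, 0 ≤ B ∧ ∀ n : ℕ, ScaleBound d b n (B * ((n : ℝ) + 1) ^ (-(4 / 3) : ℝ)) := by
  obtain ⟨hd, hm⟩ | ⟨hd, hm⟩ := h
  · refine exists_forall_scaleBound (a := 2) (β := 1) hm hb hd (by norm_num) (by norm_num)
      zero_le_one ?_ (by norm_num)
    rw [Real.rpow_one]
    exact_mod_cast hm
  · refine exists_forall_scaleBound (a := 1) (β := 2 / 3) (by lia) hb hd (by norm_num)
      (by norm_num) (by norm_num) ?_ (by norm_num)
    calc (2 : ℝ) = 8 ^ (1 / 3 : ℝ) := by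
          rw [show (8 : ℝ) = 2 ^ (3 : ℝ) by norm_num, ← Real.rpow_mul zero_le_two]
          norm_num
      _ ≤ 9 ^ (1 / 3 : ℝ) := by gcongr; norm_num
      _ = 3 ^ (2 / 3 : ℝ) := by
          rw [show (9 : ℝ) = 3 ^ (2 : ℝ) by norm_num, ← Real.rpow_mul (by norm_num)]
          norm_num
      _ ≤ (m : ℝ) ^ (2 / 3 : ℝ) := by gcongr; exact_mod_cast hm

end Decay

/-! ### The resistance to infinity -/

section Infinity

variable {d m : ℕ} {f e : Ray m → ℝ}

theorem cylSum_le_finsum (he : ∀ x, 0 ≤ e x) (hsupp : HasFiniteSupport e) (n : ℕ) (t : Ray m) :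
    cylSum e n t ≤ ∑ᶠ x, e x := by
  classical
  rw [finsum_eq_sum e hsupp]
  calc cylSum e n t = ∑ x ∈ (words (Fin m) n).image (· ⊳ t), e x :=
        (Finset.sum_image (appRay_injOn_words n t)).symm
    _ ≤ ∑ x ∈ hsupp.toFinset, e x := by
        refine (Finset.sum_filter_ne_zero _).symm.trans_le
          (Finset.sum_le_sum_of_subset_of_nonneg ?_ fun x _ _ => he x)
        intro x hx
        exact (Set.Finite.mem_toFinset hsupp).2 (Finset.mem_filter.1 hx).2

theorem abs_cylMean_le (hf : HasFiniteSupport f) (n : ℕ) (t : Ray m) :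
    |cylMean f n t| ≤ (∑ᶠ x, |f x|) / m ^ n := by
  have hsupp : HasFiniteSupport fun x => |f x| := hf.subset fun x hx => by simpa using hx
  calc |cylMean f n t| ≤ cylSum (fun x => |f x|) n t / m ^ n := by
        rw [cylMean, Finset.expect_eq_sum_div_card, card_words, abs_div, Nat.cast_pow]
        simp only [Fintype.card_fin, abs_pow, Nat.abs_cast]
        gcongr
        exact Finset.abs_sum_le_sum_abs _ _
    _ ≤ (∑ᶠ x, |f x|) / m ^ n := by
        gcongr
        exact cylSum_le_finsum (fun x => abs_nonneg (f x)) hsupp n t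

theorem tendsto_cylMean_atTop (hm : 2 ≤ m) (hf : HasFiniteSupport f) (t : Ray m) :
    Filter.Tendsto (fun n => cylMean f n t) Filter.atTop (nhds 0) := by
  refine squeeze_zero_norm (abs_cylMean_le hf · t) ?_
  have hm' : (1 : ℝ) < m := mod_cast hm
  simpa [div_eq_mul_inv] using
    (tendsto_pow_atTop_nhds_zero_of_lt_one (by positivity) (inv_lt_one_of_one_lt₀ hm')).const_mul
      (∑ᶠ x, |f x|)

variable [NeZero m] {b : Fin m}

theorem resistanceToInftyLE_zeroRay (hm : 2 ≤ m) (hb : b ≠ 0) {r : ℕ → ℝ} {R : ℝ}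
    (hr : ∀ j, 0 ≤ r j) (hR : ∀ n, ∑ j ∈ Finset.range n, r j ≤ R)
    (h : ∀ n, ScaleBound d b n (r n)) :
    ResistanceToInftyLE (motherAction d m) (zeroRay m) (48 * R + 2) := by
  intro f hf
  have hmaj := energyMajorant_energyDensity d f
  have hR0 : 0 ≤ R := by simpa using hR 0
  have hspread (p : ℕ) : (cylMean f (p + 1) (zeroRay m) - f (zeroRay m)) ^ 2 ≤
      (48 * R + 2) * ∑ᶠ x, energyDensity (motherAction d m) f x := by
    have h := spreadBound_zero_left_succ (p := p) hb hr (fun j _ => h j) hmaj (zeroRay m)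
    rw [sparseMean, replicate_zero_appRay_zeroRay] at h
    refine h.trans ?_
    gcongr
    · exact cylSum_nonneg hmaj.nonneg _ _
    · exact hR (p + 1)
    · exact cylSum_le_finsum hmaj.nonneg (hasFiniteSupport_energyDensity _ hf) _ _
  have hlim := ((tendsto_cylMean_atTop hm hf (zeroRay m)).comp
    (Filter.tendsto_add_atTop_nat 1)).sub_const (f (zeroRay m))
  simpa using le_of_tendsto' (hlim.pow 2) hspread

end Infinity

theorem propositionp (d m : ℕ) [NeZero m] (h : (4 ≤ d ∧ 2 ≤ m) ∨ (3 ≤ d ∧ 3 ≤ m)) :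
    IsTransientSchreier (fractalMotherGraph d m) := by
  have hm : 2 ≤ m := by lia
  have hb : (⟨1, hm⟩ : Fin m) ≠ 0 := by simp [Fin.ext_iff]
  obtain ⟨B, hB, hscale⟩ := exists_forall_scaleBound_of_degree h hb
  obtain ⟨W, -, hW⟩ := exists_forall_sum_rpow_neg_le (θ := 4 / 3) (by norm_num)
  have hsum (n : ℕ) : ∑ j ∈ Finset.range n, B * ((j : ℝ) + 1) ^ (-(4 / 3) : ℝ) ≤ B * W := by
    rw [← Finset.mul_sum]
    exact mul_le_mul_of_nonneg_left (hW n) hB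
  exact (resistanceToInftyLE_zeroRay hm hb (fun j => by positivity) hsum
    hscale).isTransientSchreier
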